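/- **Simple neural programs.** A *simple neural program* (SNP) $P$ with $I$ inputs and $V$ variables (inputs included) has a variable context, which declares each variable as one of the inputs $x_1,\dots,x_I$ (each input being declared exactly once), or as an integer or boolean variable with a fixed initial value, followed by a sequence of statements of the following kinds ($a,b$ stand for a variable or a fixed nonnegative integer, $i,j,k,\mathrm{cond}$ for variables): assignment $i=a$; `i = a if cond else b` with `cond` boolean; $i=j+c$ with $c\in\mathbb Z$ fixed; $i=c\cdot j$ with $c\in\mathbb N_0$ fixed; $i=j+k$; $i=j-k$; comparisons `i = (j r c)` and `i = (j r k)` with $r\in\{=,<,>,\le,\ge\}$, fixed $c\in\mathbb N_0$ and $i$ boolean; and loops `for i = a,...,b:` followed by a clause, i.e. a block of such statements, possibly with further loops, which modifies neither the counter $i$ nor the final variable $b$. The loop sets $i$ to $a$, repeats the clause while $i\le b$ (with $b$ as it is at the start of the loop), and increments $i$ by one after each repetition. The program ends with a statement that returns a variable. Its *length* $L$ is the number of all statements, including those in clauses and the return statement, but not the declarations. With $[N]=\{1,\dots,N\}$, $P$ is *$B$-bounded* on $[N]^I$ if the constants in its statements are at most $B$ and, for every input in $[N]^I$, throughout the run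 all variables are nonnegative integers at most $B$, with boolean variables in $\{0,1\}$. $P(x)$ denotes the output on input $x$. **Networks.** A *ReLU network* with $I$ inputs is a map $g_D\circ\sigma\circ g_{D-1}\circ\cdots\circ\sigma\circ g_1$, $D\ge1$, where $\sigma(t)=\max(t,0)$ acts componentwise and $g_l(\mathbf x)=W^{(l)}\mathbf x+b^{(l)}$ with integer weights and biases, hidden layers have arbitrary positive widths, and there is one output node. It is applied to a vector of which $I$ coordinates are free variables (filled by the inputs in order) and the other coordinates, if any, are fixed integers. Networks are distinguished by these data (layer dimensions, parameters, input vector). **Description length.** The alphabet is $\{\mathcal I,\ \texttt{,}\ ,-,0,1,*,(,),\mathcal W,\mathcal B\}$. The *full encoding* of a network is the comma-separated list of the coordinates of its input vector ($\mathcal I$ for a free variable, the binary expansion for a fixed coordinate), and then, for each layer in order, $\mathcal W$, the entries of the weight matrix row by row in binary, $\mathcal B$, the entries of the bias vector in binary; negative integers carry a leading $-$. A string *describes* a network if it becomes the full encoding when all repetitions $(u)*k$ (the substring $u$ repeated $k$ times, $k$ written in binary and read as far as there are digits) are expanded; repetitions may be nested. The *description length* of a network is the least length of a string that describes it. **Theorem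 5.1.** There is an absolute constant $c_3>0$ such that the following holds. Let $P$ be an SNP of length $L$ with $I$ inputs and $V$ variables (so $V\ge I$) which is $B$-bounded on $[N]^I$, where $B=B(N)\ge2$ is an integer. Let $\varepsilon>0$, $\delta\in(0,1)$, and let $n$ be an integer with $$n\ \ge\ \frac{c_3L^3V^2\ln B(N)+\ln\frac1\delta}{\varepsilon}.$$ Let $X_1,\dots,X_n$ be i.i.d. with an arbitrary distribution $\mu$ on $[N]^I$, and let $Y_i=P(X_i)$. Then with probability at least $1-\delta$ the following holds: among the ReLU networks $f$ with $f(X_i)=Y_i$ for all $i$ there is one of minimum description length, and every such minimum-description-length interpolating network $\hat f$ satisfies $$\mu\bigl(\{x\in[N]^I:\hat f(x)\ne P(x)\}\bigr)\le\varepsilon .$$ -/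

import Mathlib

open MeasureTheory ProbabilityTheory

namespace MDL

/-! ### Simple neural programs -/

/-- Declaration of a variable in a context with `I` inputs: the `k`-th program input, an integer
variable with its initial value, or a boolean variable with its initial value. -/
inductive VarDecl (I : ℕ) : Type
  | input (k : Fin I)
  | int (c : ℕ)
  | bool (b : Bool)

/-- `IsBool d`: the declaration `d` declares a boolean variable. -/
def VarDecl.IsBool {I : ℕ} : VarDecl I → Prop
  | .bool _ => True
  | _ => False

/-- A quantity that is either a variable or a fixed nonnegative integer. -/
inductive Operand (V : ℕ) : Type
  | var (v : Fin V)
  | const (c : ℕ)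

/-- The comparisons `==`, `<`, `>`, `<=`, `>=`. -/
inductive Cmp : Type
  | eq | lt | gt | le | ge

/-- The statements other than `for` and `return`. -/
inductive Simple (V : ℕ) : Type
  /-- `i = a` -/
  | assign (i : Fin V) (a : Operand V)
  /-- `i = a if cond else b` -/
  | ite (i : Fin V) (a : Operand V) (cond : Fin V) (b : Operand V)
  /-- `i = j + c`, where the integer `c` may be negative -/
  | addConst (i j : Fin V) (c : ℤ)
  /-- `i = c * j` -/
  | mulConst (i : Fin V) (c : ℕ) (j : Fin V)
  /-- `i = (j r c)` -/
  | cmpConst (i : Fin V) (r : Cmp) (j : Fin V) (c : ℕ)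
  /-- `i = j + k` -/
  | add (i j k : Fin V)
  /-- `i = j - k` -/
  | sub (i j k : Fin V)
  /-- `i = (j r k)` -/
  | cmp (i : Fin V) (r : Cmp) (j k : Fin V)

/-- A block of statements: the empty block, a simple statement followed by a block, or
`for i = s,...,e:` with clause `body`, followed by a block. -/
inductive Code (V : ℕ) : Type
  | done
  | step (s : Simple V) (rest : Code V)
  | loop (i : Fin V) (s e : Operand V) (body rest : Code V)

/-- Runtime values of the variables. They are kept in `ℤ`; that they are nonnegative is a
requirement on the run of a program (see `SNP.IsBounded`). -/
abbrev State (V : ℕ) : Type := Fin V → ℤ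

def Operand.val {V : ℕ} (σ : State V) : Operand V → ℤ
  | .var v => σ v
  | .const c => c

/-- The value `0` or `1` of a comparison. -/
def Cmp.val : Cmp → ℤ → ℤ → ℤ
  | .eq, x, y => if x = y then 1 else 0
  | .lt, x, y => if x < y then 1 else 0
  | .gt, x, y => if x > y then 1 else 0
  | .le, x, y => if x ≤ y then 1 else 0
  | .ge, x, y => if x ≥ y then 1 else 0

namespace Simple

/-- The variable to which a simple statement assigns. -/
def target {V : ℕ} : Simple V → Fin V
  | assign i _ => i
  | ite i _ _ _ => i
  | addConst i _ _ => i
  | mulConst i _ _ => i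
  | cmpConst i _ _ _ => i
  | add i _ _ => i
  | sub i _ _ => i
  | cmp i _ _ _ => i

/-- The value which a simple statement assigns. -/
def val {V : ℕ} (σ : State V) : Simple V → ℤ
  | assign _ a => a.val σ
  | ite _ a c b => if σ c = 1 then a.val σ else b.val σ
  | addConst _ j c => σ j + c
  | mulConst _ c j => c * σ j
  | cmpConst _ r j c => r.val (σ j) c
  | add _ j k => σ j + σ k
  | sub _ j k => σ j - σ k
  | cmp _ r j k => r.val (σ j) (σ k)

def exec {V : ℕ} (s : Simple V) (σ : State V) : State V :=
  Function.update σ s.target (s.val σ)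

/-- Conditions are boolean variables, and results of comparisons go to boolean variables. -/
def WellTyped {I V : ℕ} (decl : Fin V → VarDecl I) : Simple V → Prop
  | ite _ _ c _ => (decl c).IsBool
  | cmpConst i _ _ _ => (decl i).IsBool
  | cmp i _ _ _ => (decl i).IsBool
  | _ => True

end Simple

/-- The constant of an operand, if any, is at most `B`. -/
def Operand.ConstLE {V : ℕ} (B : ℕ) : Operand V → Prop
  | .var _ => True
  | .const c => c ≤ B

/-- All constants of a simple statement are at most `B`. -/
def Simple.ConstLE {V : ℕ} (B : ℕ) : Simple V → Prop
  | assign _ a => a.ConstLE B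
  | ite _ a _ b => a.ConstLE B ∧ b.ConstLE B
  | addConst _ _ c => c ≤ (B : ℤ)
  | mulConst _ c _ => c ≤ B
  | cmpConst _ _ _ c => c ≤ B
  | _ => True

namespace Code

/-- The number of statements, including those in the clauses of loops. -/
def length {V : ℕ} : Code V → ℕ
  | done => 0
  | step _ k => 1 + k.length
  | loop _ _ _ body k => 1 + body.length + k.length

/-- Some statement of the block (possibly nested in a clause) modifies the variable `v`. -/
def Modifies {V : ℕ} (v : Fin V) : Code V → Prop
  | done => False
  | step s k => s.target = v ∨ k.Modifies v
  | loop i _ _ body k => i = v ∨ body.Modifies v ∨ k.Modifies v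

/-- Statements are well typed, and no clause modifies the counter or the final variable
of its loop. -/
def WellFormed {I V : ℕ} (decl : Fin V → VarDecl I) : Code V → Prop
  | done => True
  | step s k => s.WellTyped decl ∧ k.WellFormed decl
  | loop i _ e body k =>
      ¬ body.Modifies i ∧ (∀ v, e = .var v → ¬ body.Modifies v) ∧
        body.WellFormed decl ∧ k.WellFormed decl

/-- All constants in the block are at most `B`. -/
def ConstLE {V : ℕ} (B : ℕ) : Code V → Prop
  | done => True
  | step s k => s.ConstLE B ∧ k.ConstLE B
  | loop _ s e body k => s.ConstLE B ∧ e.ConstLE B ∧ body.ConstLE B ∧ k.ConstLE B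

/-- The state after the execution of a block. A loop `for i = s,...,e` sets `i` to the value of
`s`; then the clause is executed `e - s + 1` times (not at all if `s > e`), and `i` is incremented
by one after each repetition. -/
def exec {V : ℕ} : Code V → State V → State V
  | done, σ => σ
  | step s k, σ => k.exec (s.exec σ)
  | loop i s e body k, σ =>
      k.exec ((fun τ => Function.update (body.exec τ) i (body.exec τ i + 1))^[
        (e.val σ + 1 - s.val σ).toNat] (Function.update σ i (s.val σ)))

/-- Every state that occurs in the execution of a block, including the first one and the last
one, satisfies `p`. -/
def AllStates {V : ℕ} (p : State V → Prop) : Code V → State V → Prop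
  | done, σ => p σ
  | step s k, σ => p σ ∧ k.AllStates p (s.exec σ)
  | loop i s e body k, σ =>
      p σ ∧
      (∀ j < (e.val σ + 1 - s.val σ).toNat,
        body.AllStates p ((fun τ => Function.update (body.exec τ) i (body.exec τ i + 1))^[j]
          (Function.update σ i (s.val σ)))) ∧
      k.AllStates p ((fun τ => Function.update (body.exec τ) i (body.exec τ i + 1))^[
        (e.val σ + 1 - s.val σ).toNat] (Function.update σ i (s.val σ)))

end Code

/-- A simple neural program with `I` inputs and `V` variables (inputs included): a variable
context in which every input is declared exactly once, a block of statements, and a final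
`return ret`. -/
structure SNP (I V : ℕ) where
  decl : Fin V → VarDecl I
  input_once : ∀ k, ∃! v, decl v = VarDecl.input k
  code : Code V
  ret : Fin V
  wf : code.WellFormed decl

/-- The grid `[N]^I` with `[N] = {1, …, N}`. -/
abbrev Grid (N I : ℕ) : Type := Fin I → Set.Icc 1 N

/-- A grid point as an integer vector. -/
def Grid.toInt {N I : ℕ} (x : Grid N I) : Fin I → ℤ := fun k => ((x k : ℕ) : ℤ)

namespace SNP

variable {I V : ℕ}

/-- The number of statements, including the `return` statement. -/
def length (P : SNP I V) : ℕ := P.code.length + 1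

/-- The initial state on input `x`. -/
def init (P : SNP I V) (x : Fin I → ℤ) : State V := fun v =>
  match P.decl v with
  | .input k => x k
  | .int c => c
  | .bool b => if b then 1 else 0

/-- The output of the program on input `x`. -/
def eval (P : SNP I V) (x : Fin I → ℤ) : ℤ := P.code.exec (P.init x) P.ret

/-- The program is `B`-bounded on `[N]^I`: its constants are at most `B`, and on every input from
`[N]^I` all variables are, at all times, nonnegative integers and at most `B`, boolean variables
being `0` or `1`. -/
def IsBounded (P : SNP I V) (N B : ℕ) : Prop :=
  P.code.ConstLE B ∧
    ∀ x : Grid N I, P.code.AllStates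
      (fun σ => ∀ v, 0 ≤ σ v ∧ σ v ≤ B ∧ ((P.decl v).IsBool → σ v ≤ 1)) (P.init x.toInt)

end SNP

/-! ### ReLU networks -/

/-- An affine layer with integer weights and biases, with `n` inputs and `m` outputs. -/
structure Layer (n m : ℕ) where
  W : Matrix (Fin m) (Fin n) ℤ
  b : Fin m → ℤ

def Layer.apply {n m : ℕ} (g : Layer n m) (x : Fin n → ℤ) : Fin m → ℤ := g.W.mulVec x + g.b

/-- A nonempty sequence of layers with input dimension `n` and a single output node; the hidden
layers have arbitrary positive widths. -/
inductive Layers : ℕ → Type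
  | last {n : ℕ} (g : Layer n 1) : Layers n
  | cons {n m : ℕ} (hm : 0 < m) (g : Layer n m) (rest : Layers m) : Layers n

/-- The composition of the layers with a componentwise ReLU between consecutive layers. -/
def Layers.eval : {n : ℕ} → Layers n → (Fin n → ℤ) → ℤ
  | _, .last g, x => g.apply x 0
  | _, .cons _ g rest, x => rest.eval (fun r => max (g.apply x r) 0)

/-- Specification of an input vector with `n` coordinates, `I` of which are free variables while
the others are fixed integers. -/
inductive InputSpec : ℕ → ℕ → Type
  | nil : InputSpec 0 0
  | free {I n : ℕ} (s : InputSpec I n) : InputSpec (I + 1) (n + 1)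
  | fixed {I n : ℕ} (c : ℤ) (s : InputSpec I n) : InputSpec I (n + 1)

/-- The input vector in which the free coordinates are, in order, the coordinates of `x`. -/
def InputSpec.fill : {I n : ℕ} → InputSpec I n → (Fin I → ℤ) → (Fin n → ℤ)
  | _, _, .nil, _ => Fin.elim0
  | _, _, .free s, x => Fin.cons (x 0) (s.fill (Fin.tail x))
  | _, _, .fixed c s, x => Fin.cons c (s.fill x)

/-- A feedforward ReLU network with integer parameters, `I` free inputs and one output. -/
structure Network (I : ℕ) where
  dim : ℕ
  inputs : InputSpec I dim
  layers : Layers dim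

/-- The output of a network; inputs and parameters being integers, so are all values. -/
def Network.eval {I : ℕ} (F : Network I) (x : Fin I → ℤ) : ℤ := F.layers.eval (F.inputs.fill x)

/-! ### Description length -/

/-- The alphabet. -/
inductive Letter : Type
  | inp | comma | minus | zero | one | star | lparen | rparen | weight | bias
  deriving DecidableEq

/-- Binary expansion, most significant digit first; that of `0` is the digit `0`. -/
def bin (n : ℕ) : List Letter :=
  if n = 0 then [.zero] else n.bits.reverse.map (fun d => if d then Letter.one else Letter.zero)

/-- Binary expansion of an integer, preceded by a minus sign if it is negative. -/
def binInt (z : ℤ) : List Letter :=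
  if z < 0 then .minus :: bin z.natAbs else bin z.natAbs

/-- The entries of an input vector: the input symbol for a free variable, the binary expansion
for a fixed coordinate. -/
def InputSpec.tokens : {I n : ℕ} → InputSpec I n → List (List Letter)
  | _, _, .nil => []
  | _, _, .free s => [.inp] :: s.tokens
  | _, _, .fixed c s => binInt c :: s.tokens

/-- The weight symbol, the entries of the weight matrix row by row, the bias symbol, the entries
of the bias vector. -/
def Layer.tokens {n m : ℕ} (g : Layer n m) : List (List Letter) :=
  [.weight] :: (List.ofFn fun r => List.ofFn fun c => binInt (g.W r c)).flatten ++
    [.bias] :: List.ofFn fun r => binInt (g.b r)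

def Layers.tokens : {n : ℕ} → Layers n → List (List Letter)
  | _, .last g => g.tokens
  | _, .cons _ g rest => g.tokens ++ rest.tokens

/-- The full symbol encoding: the entries of the input vector, then the parameters of all layers,
separated by commas. -/
def Network.encode {I : ℕ} (F : Network I) : List Letter :=
  List.intercalate [.comma] (F.inputs.tokens ++ F.layers.tokens)

/-- `Expands s t`: the string `s` becomes `t` when all repetitions `(u)*k`, with `k` in binary, are
expanded; they may be nested. After `*`, the number `k` extends as far as there are binary digits,
so that a string has at most one expansion. -/
inductive Expands : List Letter → List Letter → Prop
  | nil : Expands [] []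
  | letter (a : Letter) (ha : a ≠ .lparen ∧ a ≠ .rparen ∧ a ≠ .star) {s t : List Letter}
      (h : Expands s t) : Expands (a :: s) (a :: t)
  | rep (k : ℕ) {u v s t : List Letter} (hu : Expands u v) (hs : Expands s t)
      (hd : s.head? ≠ some .zero ∧ s.head? ≠ some .one) :
      Expands (.lparen :: u ++ .rparen :: .star :: bin k ++ s) ((List.replicate k v).flatten ++ t)

/-- A string describes a network if it expands to the full symbol encoding of the network. -/
def Describes {I : ℕ} (s : List Letter) (F : Network I) : Prop := Expands s F.encode

/-- The description length: the least length of a string that describes the network (the full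
symbol encoding is one, so that this is a minimum over a nonempty set). -/
noncomputable def Network.descLength {I : ℕ} (F : Network I) : ℕ :=
  sInf {l | ∃ s, Describes s F ∧ s.length = l}

/-- `F` takes the value `y i` at `x i` for every `i`. -/
def Interpolates {I n : ℕ} (F : Network I) (x : Fin n → Fin I → ℤ) (y : Fin n → ℤ) : Prop :=
  ∀ i, F.eval (x i) = y i

/-- `F` is an interpolating network of minimum description length among all interpolating
networks. -/
def IsMDLInterpolator {I n : ℕ} (F : Network I) (x : Fin n → Fin I → ℤ) (y : Fin n → ℤ) : Prop :=
  Interpolates F x y ∧ ∀ G : Network I, Interpolates G x y → F.descLength ≤ G.descLength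

end MDL

namespace MDL

/-! ### Binary expansions -/

/-- The number denoted by a string of binary digits, most significant digit first. -/
def binVal (l : List Letter) : ℕ := l.foldl (fun a d => 2 * a + if d = .one then 1 else 0) 0

theorem binVal_bits (n : ℕ) :
    binVal (n.bits.reverse.map (fun d => if d then Letter.one else Letter.zero)) = n := by
  induction n using Nat.binaryRec' with
  | zero => simp [binVal]
  | bit b n h ih =>
    rw [Nat.bits_append_bit _ _ h]
    simp only [binVal, List.reverse_cons, List.map_append, List.map_cons, List.map_nil,
      List.foldl_append, List.foldl_cons, List.foldl_nil] at ih ⊢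
    rw [ih]
    cases b <;> simp [Nat.bit]

theorem binVal_bin (n : ℕ) : binVal (bin n) = n := by
  unfold bin
  split_ifs with h
  · simp [h, binVal]
  · exact binVal_bits n

theorem bin_injective : Function.Injective bin :=
  Function.LeftInverse.injective binVal_bin

theorem digit_of_mem_bin {n : ℕ} {a : Letter} (h : a ∈ bin n) : a = .zero ∨ a = .one := by
  unfold bin at h
  split_ifs at h with h0
  · simp at h; exact Or.inl h
  · simp only [List.mem_map] at h
    obtain ⟨d, -, rfl⟩ := h
    cases d <;> simp

theorem letter_of_mem_binInt {z : ℤ} {a : Letter} (h : a ∈ binInt z) :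
    a = .minus ∨ a = .zero ∨ a = .one := by
  unfold binInt at h
  split_ifs at h
  · rcases List.mem_cons.1 h with h | h
    · exact Or.inl h
    · exact Or.inr (digit_of_mem_bin h)
  · exact Or.inr (digit_of_mem_bin h)

theorem binInt_injective : Function.Injective binInt := by
  have key : ∀ m n : ℕ, Letter.minus :: bin m ≠ bin n := by
    intro m n h
    have := digit_of_mem_bin (n := n) (a := .minus) (h ▸ List.mem_cons_self)
    simp at this
  intro a b h
  unfold binInt at h
  split_ifs at h with ha hb hb
  · have := bin_injective (List.cons.inj h).2
    omega
  · exact absurd h (key _ _)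
  · exact absurd h.symm (key _ _)
  · have := bin_injective h
    omega

theorem length_bin_le (n : ℕ) : (bin n).length ≤ n.size + 1 := by
  unfold bin
  split_ifs with h
  · simp
  · simp [Nat.size_eq_bits_len]

theorem length_binInt_le {z : ℤ} {k : ℕ} (h : z.natAbs < 2 ^ k) : (binInt z).length ≤ k + 2 := by
  have h1 := length_bin_le z.natAbs
  have h2 := Nat.size_le.2 h
  unfold binInt
  split_ifs
  · simp; omega
  · omega

/-! ### Expansions are unique -/

theorem digits_append_inj {l l' x x' : List Letter}
    (hl : ∀ a ∈ l, a = .zero ∨ a = .one) (hl' : ∀ a ∈ l', a = .zero ∨ a = .one)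
    (hx : x.head? ≠ some .zero ∧ x.head? ≠ some .one)
    (hx' : x'.head? ≠ some .zero ∧ x'.head? ≠ some .one)
    (h : l ++ x = l' ++ x') : l = l' ∧ x = x' := by
  induction l generalizing l' with
  | nil =>
    cases l' with
    | nil => simpa using h
    | cons a l' =>
      have := hl' a (by simp)
      simp only [List.nil_append] at h
      subst h
      simp at hx
      tauto
  | cons a l ih =>
    cases l' with
    | nil =>
      have := hl a (by simp)
      simp only [List.nil_append] at h
      subst h
      simp at hx'
      tauto
    | cons b l' =>
      simp only [List.cons_append, List.cons.injEq] at h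
      obtain ⟨rfl, h⟩ := h
      obtain ⟨rfl, rfl⟩ := ih (fun a ha => hl a (by simp [ha])) (fun a ha => hl' a (by simp [ha])) h
      simp

/-- A string that is empty or starts with a right parenthesis. -/
def Closes (r : List Letter) : Prop := r = [] ∨ ∃ r', r = .rparen :: r'

theorem Closes.head {s r : List Letter} (hr : Closes r)
    (hd : s.head? ≠ some .zero ∧ s.head? ≠ some .one) :
    (s ++ r).head? ≠ some .zero ∧ (s ++ r).head? ≠ some .one := by
  cases s with
  | nil => rcases hr with rfl | ⟨r', rfl⟩ <;> simp
  | cons a s => simpa using hd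

theorem Expands.unique_prefix {s t : List Letter} (h : Expands s t) :
    ∀ {s' t' r r' : List Letter}, Expands s' t' → Closes r → Closes r' → s ++ r = s' ++ r' →
      s = s' ∧ t = t' := by
  induction h with
  | nil =>
    intro s' t' r r' h' hr hr' he
    cases h' with
    | nil => simp
    | letter a ha h => rcases hr with rfl | ⟨_, rfl⟩ <;> simp at he; simp [← he.1] at ha
    | rep k hu hs hd => rcases hr with rfl | ⟨_, rfl⟩ <;> simp at he
  | letter a ha h ih =>
    intro s' t' r r' h' hr hr' he
    cases h' with
    | nil => rcases hr' with rfl | ⟨_, rfl⟩ <;> simp at he; simp [he.1] at ha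
    | letter b hb h' =>
      simp only [List.cons_append, List.cons.injEq] at he
      obtain ⟨rfl, rfl⟩ := ih h' hr hr' he.2
      simp [he.1]
    | rep k hu hs hd => simp at he; simp [he.1] at ha
  | @rep k u v s t hu hs hd ihu ihs =>
    intro s' t' r r' h' hr hr' he
    cases h' with
    | nil => rcases hr' with rfl | ⟨_, rfl⟩ <;> simp at he
    | letter b hb h' => simp at he; simp [← he.1] at hb
    | @rep k' u' v' s' t' hu' hs' hd' =>
      simp only [List.cons_append, List.append_assoc, List.cons.injEq, true_and] at he
      obtain ⟨rfl, rfl⟩ := ihu hu' (Or.inr ⟨_, rfl⟩) (Or.inr ⟨_, rfl⟩) he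
      simp only [List.append_cancel_left_eq, List.cons.injEq, true_and] at he
      obtain ⟨h1, h2⟩ := digits_append_inj (fun _ => digit_of_mem_bin) (fun _ => digit_of_mem_bin)
        (hr.head hd) (hr'.head hd') he
      obtain rfl := bin_injective h1
      obtain ⟨rfl, rfl⟩ := ihs hs' hr hr' h2
      simp

theorem Expands.unique {s t t' : List Letter} (h : Expands s t) (h' : Expands s t') : t = t' :=
  (h.unique_prefix h' (r := []) (r' := []) (Or.inl rfl) (Or.inl rfl) rfl).2

theorem expands_append_of_plain {l s t : List Letter}
    (hl : ∀ a ∈ l, a ≠ .lparen ∧ a ≠ .rparen ∧ a ≠ .star) (h : Expands s t) :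
    Expands (l ++ s) (l ++ t) := by
  induction l with
  | nil => exact h
  | cons a l ih => exact .letter a (hl a (by simp)) (ih fun b hb => hl b (by simp [hb]))

/-! ### The full encoding determines the network -/

/-- The possible tokens of an input vector or of a layer contain only these letters. -/
def IsToken (l : List Letter) : Prop :=
  l = [.weight] ∨ l = [.bias] ∨ l = [.inp] ∨ ∃ z, l = binInt z

theorem IsToken.plain {l : List Letter} (h : IsToken l) {a : Letter} (ha : a ∈ l) :
    a ≠ .comma ∧ a ≠ .lparen ∧ a ≠ .rparen ∧ a ≠ .star := by
  rcases h with rfl | rfl | rfl | ⟨z, rfl⟩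
  · simp at ha; simp [ha]
  · simp at ha; simp [ha]
  · simp at ha; simp [ha]
  · rcases letter_of_mem_binInt ha with rfl | rfl | rfl <;> simp

theorem binInt_ne (z : ℤ) : binInt z ≠ [.weight] ∧ binInt z ≠ [.bias] ∧ binInt z ≠ [.inp] := by
  refine ⟨fun h => ?_, fun h => ?_, fun h => ?_⟩
  · simpa using letter_of_mem_binInt (z := z) (a := .weight) (by simp [h])
  · simpa using letter_of_mem_binInt (z := z) (a := .bias) (by simp [h])
  · simpa using letter_of_mem_binInt (z := z) (a := .inp) (by simp [h])

theorem InputSpec.isToken {I n : ℕ} (s : InputSpec I n) : ∀ l ∈ s.tokens, IsToken l := by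
  induction s with
  | nil => simp [InputSpec.tokens]
  | free s ih =>
    intro l hl
    rcases List.mem_cons.1 hl with rfl | hl
    · simp [IsToken]
    · exact ih l hl
  | fixed c s ih =>
    intro l hl
    rcases List.mem_cons.1 hl with rfl | hl
    · exact Or.inr (Or.inr (Or.inr ⟨_, rfl⟩))
    · exact ih l hl

theorem Layer.isToken {n m : ℕ} (g : Layer n m) : ∀ l ∈ g.tokens, IsToken l := by
  intro l hl
  simp only [Layer.tokens, List.mem_append, List.mem_cons, List.mem_flatten, List.mem_ofFn] at hl
  rcases hl with (rfl | ⟨_, ⟨r, rfl⟩, hl⟩) | rfl | ⟨r, rfl⟩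
  · simp [IsToken]
  · simp only [List.mem_ofFn] at hl
    obtain ⟨c, rfl⟩ := hl
    exact Or.inr (Or.inr (Or.inr ⟨_, rfl⟩))
  · simp [IsToken]
  · exact Or.inr (Or.inr (Or.inr ⟨_, rfl⟩))

theorem Layers.isToken {n : ℕ} (g : Layers n) : ∀ l ∈ g.tokens, IsToken l := by
  induction g with
  | last g => exact g.isToken
  | cons hm g rest ih =>
    intro l hl
    rcases List.mem_append.1 hl with hl | hl
    · exact g.isToken l hl
    · exact ih l hl

theorem Layers.exists_tokens_eq {n : ℕ} (g : Layers n) : ∃ T, g.tokens = [.weight] :: T := by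
  cases g <;> simp [Layers.tokens, Layer.tokens]

/-- Two lists that are split at the first occurrence of `w` are equal only if their parts are. -/
theorem append_cons_inj {α : Type*} {w : α} {l l' T T' : List α} (hl : w ∉ l) (hl' : w ∉ l')
    (h : l ++ w :: T = l' ++ w :: T') : l = l' ∧ T = T' := by
  induction l generalizing l' with
  | nil =>
    cases l' with
    | nil => simpa using h
    | cons a l' => simp at h hl'; exact absurd h.1 hl'.1
  | cons a l ih =>
    cases l' with
    | nil => simp at h hl; exact absurd h.1.symm hl.1
    | cons b l' =>
      simp only [List.cons_append, List.cons.injEq] at h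
      simp only [List.mem_cons, not_or] at hl hl'
      obtain ⟨rfl, rfl⟩ := ih hl.2 hl'.2 h.2
      simp [h.1]

/-- A list of tokens that is empty or starts a new layer. -/
def StartsLayer (T : List (List Letter)) : Prop := T = [] ∨ ∃ T', T = [.weight] :: T'

theorem StartsLayer.append_inj {l l' T T' : List (List Letter)} (hT : StartsLayer T)
    (hT' : StartsLayer T') (hl : [Letter.weight] ∉ l) (hl' : [Letter.weight] ∉ l')
    (h : l ++ T = l' ++ T') : l = l' ∧ T = T' := by
  rcases hT with rfl | ⟨T, rfl⟩ <;> rcases hT' with rfl | ⟨T', rfl⟩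
  · simpa using h
  · exact absurd (by rw [List.append_nil] at h; simp [h]) hl
  · exact absurd (by rw [List.append_nil] at h; simp [← h]) hl'
  · obtain ⟨rfl, rfl⟩ := append_cons_inj hl hl' h
    simp

theorem Layer.tokens_append_inj {n m m' : ℕ} (g : Layer n m) (g' : Layer n m')
    {T T' : List (List Letter)} (hT : StartsLayer T) (hT' : StartsLayer T')
    (h : g.tokens ++ T = g'.tokens ++ T') : m = m' ∧ HEq g g' ∧ T = T' := by
  simp only [Layer.tokens, List.cons_append, List.append_assoc, List.cons.injEq, true_and] at h
  obtain ⟨h1, h2⟩ := append_cons_inj (w := [Letter.bias])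
    (by simp [List.mem_flatten, List.mem_ofFn, (binInt_ne _).2.1])
    (by simp [List.mem_flatten, List.mem_ofFn, (binInt_ne _).2.1]) h
  obtain ⟨h5, rfl⟩ := hT.append_inj hT'
    (by simp [List.mem_ofFn, (binInt_ne _).1]) (by simp [List.mem_ofFn, (binInt_ne _).1]) h2
  obtain rfl : m = m' := by simpa using congrArg List.length h5
  refine ⟨rfl, heq_of_eq ?_, rfl⟩
  have h3 := List.eq_iff_flatten_eq.2 ⟨h1, by simp [Function.comp_def]⟩
  have h4 := List.ofFn_injective h3
  have h6 := List.ofFn_injective h5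
  cases g with | mk W b => cases g' with | mk W' b' =>
  congr 1
  · ext r c
    exact binInt_injective (congrFun (List.ofFn_injective (congrFun h4 r)) c)
  · ext r
    exact binInt_injective (congrFun h6 r)

theorem Layers.tokens_injective {n : ℕ} (g g' : Layers n) (h : g.tokens = g'.tokens) : g = g' := by
  induction g with
  | last g =>
    cases g' with
    | last g' =>
      obtain ⟨-, h, -⟩ := g.tokens_append_inj g' (T := []) (T' := []) (Or.inl rfl) (Or.inl rfl)
        (by simpa [Layers.tokens] using h)
      rw [eq_of_heq h]
    | cons hm g' rest' =>
      obtain ⟨T, hT⟩ := rest'.exists_tokens_eq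
      obtain ⟨-, -, h⟩ := g.tokens_append_inj g' (T := []) (T' := rest'.tokens) (Or.inl rfl)
        (Or.inr ⟨T, hT⟩) (by simpa [Layers.tokens] using h)
      simp [hT] at h
  | cons hm g rest ih =>
    obtain ⟨T, hT⟩ := rest.exists_tokens_eq
    cases g' with
    | last g' =>
      obtain ⟨-, -, h⟩ := g.tokens_append_inj g' (T := rest.tokens) (T' := []) (Or.inr ⟨T, hT⟩)
        (Or.inl rfl) (by simpa [Layers.tokens] using h)
      simp [hT] at h
    | cons hm' g' rest' =>
      obtain ⟨T', hT'⟩ := rest'.exists_tokens_eq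
      obtain ⟨rfl, h1, h2⟩ := g.tokens_append_inj g' (Or.inr ⟨T, hT⟩) (Or.inr ⟨T', hT'⟩) h
      rw [eq_of_heq h1, ih rest' h2]

theorem InputSpec.length_tokens {I n : ℕ} (s : InputSpec I n) : s.tokens.length = n := by
  induction s <;> simp_all [InputSpec.tokens]

theorem InputSpec.weight_notMem {I n : ℕ} (s : InputSpec I n) : [Letter.weight] ∉ s.tokens := by
  induction s with
  | nil => simp [InputSpec.tokens]
  | free s ih => simpa [InputSpec.tokens] using ih
  | fixed c s ih => simpa [InputSpec.tokens, (binInt_ne c).1.symm] using ih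

theorem InputSpec.tokens_injective {I n : ℕ} (s s' : InputSpec I n) (h : s.tokens = s'.tokens) :
    s = s' := by
  induction s with
  | nil => cases s'; rfl
  | free s ih =>
    cases s' with
    | free s' =>
      simp only [InputSpec.tokens, List.cons.injEq, true_and] at h
      rw [ih s' h]
    | fixed c s' =>
      simp only [InputSpec.tokens, List.cons.injEq] at h
      exact absurd h.1.symm (binInt_ne c).2.2
  | fixed c s ih =>
    cases s' with
    | free s' =>
      simp only [InputSpec.tokens, List.cons.injEq] at h
      exact absurd h.1 (binInt_ne c).2.2
    | fixed c' s' =>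
      simp only [InputSpec.tokens, List.cons.injEq] at h
      rw [ih s' h.2, binInt_injective h.1]

theorem Network.isToken {I : ℕ} (F : Network I) :
    ∀ l ∈ F.inputs.tokens ++ F.layers.tokens, IsToken l := by
  intro l hl
  rcases List.mem_append.1 hl with hl | hl
  · exact F.inputs.isToken l hl
  · exact F.layers.isToken l hl

theorem Network.tokens_ne_nil {I : ℕ} (F : Network I) :
    F.inputs.tokens ++ F.layers.tokens ≠ [] := by
  obtain ⟨T, hT⟩ := F.layers.exists_tokens_eq
  simp [hT]

theorem Network.encode_injective {I : ℕ} : Function.Injective (Network.encode (I := I)) := by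
  intro F G h
  have h1 := congrArg (List.splitOn Letter.comma) h
  unfold Network.encode at h1
  rw [List.splitOn_intercalate _ (fun l hl hc => ((F.isToken l hl).plain hc).1 rfl)
    F.tokens_ne_nil, List.splitOn_intercalate _ (fun l hl hc => ((G.isToken l hl).plain hc).1 rfl)
    G.tokens_ne_nil] at h1
  obtain ⟨T, hT⟩ := F.layers.exists_tokens_eq
  obtain ⟨T', hT'⟩ := G.layers.exists_tokens_eq
  obtain ⟨h2, h3⟩ := StartsLayer.append_inj (Or.inr ⟨T, hT⟩) (Or.inr ⟨T', hT'⟩)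
    F.inputs.weight_notMem G.inputs.weight_notMem h1
  cases F with | mk n s g => cases G with | mk n' s' g' =>
  dsimp only at h2 h3
  obtain rfl : n = n' := by rw [← s.length_tokens, h2, s'.length_tokens]
  rw [s.tokens_injective s' h2, g.tokens_injective g' h3]

/-- The tokens of a list, each preceded by a comma. -/
def commaJoin (T : List (List Letter)) : List Letter := T.flatMap (fun l => .comma :: l)

theorem intercalate_cons_eq (l : List Letter) (T : List (List Letter)) :
    List.intercalate [.comma] (l :: T) = l ++ commaJoin T := by
  induction T generalizing l with
  | nil => simp [List.intercalate, commaJoin]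
  | cons l' T ih => rw [List.intercalate_cons_cons, ih]; simp [commaJoin]

theorem comma_cons_intercalate {T : List (List Letter)} (hT : T ≠ []) :
    .comma :: List.intercalate [.comma] T = commaJoin T := by
  cases T with
  | nil => exact absurd rfl hT
  | cons l T => rw [intercalate_cons_eq]; simp [commaJoin]

theorem commaJoin_append (T T' : List (List Letter)) :
    commaJoin (T ++ T') = commaJoin T ++ commaJoin T' := by
  simp [commaJoin]

theorem plain_commaJoin {T : List (List Letter)} (hT : ∀ l ∈ T, IsToken l) :
    ∀ a ∈ commaJoin T, a ≠ .lparen ∧ a ≠ .rparen ∧ a ≠ .star := by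
  intro a ha
  simp only [commaJoin, List.mem_flatMap, List.mem_cons] at ha
  obtain ⟨l, hl, rfl | ha⟩ := ha
  · simp
  · exact ((hT l hl).plain ha).2

theorem length_commaJoin_le {T : List (List Letter)} {k : ℕ} (hT : ∀ l ∈ T, l.length ≤ k) :
    (commaJoin T).length ≤ T.length * (k + 1) := by
  induction T with
  | nil => simp [commaJoin]
  | cons l T ih =>
    have h1 := hT l (by simp)
    have h2 := ih fun l hl => hT l (by simp [hl])
    simp only [commaJoin, List.flatMap_cons, List.length_append, List.length_cons] at h2 ⊢
    rw [Nat.add_mul]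
    omega

theorem Network.encode_describes {I : ℕ} (F : Network I) : Describes F.encode F := by
  have h : ∀ a ∈ F.encode, a ≠ .lparen ∧ a ≠ .rparen ∧ a ≠ .star := fun a ha =>
    plain_commaJoin F.isToken a (by
      rw [← comma_cons_intercalate F.tokens_ne_nil]; exact List.mem_cons_of_mem _ ha)
  simpa [Describes] using expands_append_of_plain h .nil

theorem Network.exists_describes {I : ℕ} (F : Network I) :
    ∃ s, Describes s F ∧ s.length = F.descLength :=
  Nat.sInf_mem (s := {l | ∃ s, Describes s F ∧ s.length = l}) ⟨_, _, F.encode_describes, rfl⟩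

theorem Network.descLength_le {I : ℕ} {F : Network I} {s : List Letter} (h : Describes s F) :
    F.descLength ≤ s.length :=
  Nat.sInf_le ⟨s, h, rfl⟩

theorem Describes.unique {I : ℕ} {F G : Network I} {s : List Letter} (hF : Describes s F)
    (hG : Describes s G) : F = G :=
  Network.encode_injective (Expands.unique hF hG)

/-! ### Straight-line ReLU programs with repetitions -/

/-- An affine form with integer coefficients, as a list of terms and a constant. -/
structure Affine (ι : Type) where
  terms : List (ℤ × ι)
  const : ℤ

namespace Affine

variable {ι : Type}

def eval (e : Affine ι) (x : ι → ℤ) : ℤ := (e.terms.map fun p => p.1 * x p.2).sum + e.const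

/-- The sum of the absolute values of all coefficients. -/
def mag (e : Affine ι) : ℕ := (e.terms.map fun p => p.1.natAbs).sum + e.const.natAbs

/-- The coefficient of the coordinate `c`. -/
def coeff [DecidableEq ι] (e : Affine ι) (c : ι) : ℤ :=
  (e.terms.map fun p => if p.2 = c then p.1 else 0).sum

theorem sum_coeff_mul [DecidableEq ι] [Fintype ι] (e : Affine ι) (x : ι → ℤ) :
    ∑ c, e.coeff c * x c + e.const = e.eval x := by
  obtain ⟨l, b⟩ := e
  simp only [eval, coeff, add_left_inj]
  induction l with
  | nil => simp
  | cons p l ih => simp [add_mul, Finset.sum_add_distrib, ih]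

theorem natAbs_coeff_le [DecidableEq ι] (e : Affine ι) (c : ι) : (e.coeff c).natAbs ≤ e.mag := by
  obtain ⟨l, b⟩ := e
  simp only [mag, coeff]
  refine le_trans ?_ (Nat.le_add_right _ _)
  induction l with
  | nil => simp
  | cons p l ih =>
    simp only [List.map_cons, List.sum_cons]
    refine (Int.natAbs_add_le _ _).trans (Nat.add_le_add ?_ ih)
    split_ifs <;> simp

theorem natAbs_const_le (e : Affine ι) : e.const.natAbs ≤ e.mag := Nat.le_add_left _ _

end Affine

/-- Programs built from assignments `i := max e 0` with an affine form `e`, and repetitions. -/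
inductive RProg (ι : Type) : Type
  | done
  | step (i : ι) (e : Affine ι) (rest : RProg ι)
  | rep (k : ℕ) (body rest : RProg ι)

namespace RProg

variable {ι : Type}

def exec [DecidableEq ι] : RProg ι → (ι → ℤ) → ι → ℤ
  | done, x => x
  | step i e rest, x => rest.exec (Function.update x i (max (e.eval x) 0))
  | rep k body rest, x => rest.exec (body.exec^[k] x)

def append : RProg ι → RProg ι → RProg ι
  | done, q => q
  | step i e rest, q => step i e (rest.append q)
  | rep k body rest, q => rep k body (rest.append q)

/-- The number of assignments and repetitions. -/
def size : RProg ι → ℕ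
  | done => 0
  | step _ _ rest => 1 + rest.size
  | rep _ body rest => 1 + body.size + rest.size

/-- All coefficients and all numbers of repetitions have at most `K` binary digits. -/
def DigitsLE (K : ℕ) : RProg ι → Prop
  | done => True
  | step _ e rest => e.mag < 2 ^ K ∧ rest.DigitsLE K
  | rep k body rest => k < 2 ^ K ∧ body.DigitsLE K ∧ rest.DigitsLE K

theorem exec_append [DecidableEq ι] (p q : RProg ι) (x : ι → ℤ) :
    (p.append q).exec x = q.exec (p.exec x) := by
  induction p generalizing x with
  | done => rfl
  | step i e rest ih => simp [append, exec, ih]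
  | rep k body rest _ ih => simp [append, exec, ih]

theorem size_append (p q : RProg ι) : (p.append q).size = p.size + q.size := by
  induction p with
  | done => simp [append, size]
  | step i e rest ih => simp [append, size, ih]; omega
  | rep k body rest _ ih => simp [append, size, ih]; omega

theorem DigitsLE.append {K : ℕ} {p q : RProg ι} (hp : p.DigitsLE K) (hq : q.DigitsLE K) :
    (p.append q).DigitsLE K := by
  induction p with
  | done => exact hq
  | step i e rest ih => exact ⟨hp.1, ih hp.2⟩
  | rep k body rest _ ih => exact ⟨hp.1, hp.2.1, ih hp.2.2⟩

theorem exec_nonneg [DecidableEq ι] (p : RProg ι) {x : ι → ℤ} (hx : ∀ i, 0 ≤ x i) :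
    ∀ i, 0 ≤ p.exec x i := by
  induction p generalizing x with
  | done => exact hx
  | step i e rest ih =>
    refine ih fun j => ?_
    by_cases h : j = i
    · subst h; simp
    · simpa [h] using hx j
  | rep k body rest ihb ih =>
    refine ih ?_
    clear ih
    induction k generalizing x with
    | zero => exact hx
    | succ k ihk => exact ihk (ihb hx)

end RProg

/-! ### Straight-line ReLU programs as networks -/

section Layers

variable {ι : Type} [DecidableEq ι] {D : ℕ}

/-- The layer that performs one assignment and keeps the other (nonnegative) coordinates. -/
def stepLayer (φ : ι ≃ Fin D) (i : ι) (e : Affine ι) : Layer D D where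
  W r c := if r = φ i then e.coeff (φ.symm c) else if r = c then 1 else 0
  b r := if r = φ i then e.const else 0

theorem relu_stepLayer (φ : ι ≃ Fin D) (i : ι) (e : Affine ι) {x : ι → ℤ} (hx : ∀ i, 0 ≤ x i) :
    (fun r => max ((stepLayer φ i e).apply (fun c => x (φ.symm c)) r) 0) =
      fun r => Function.update x i (max (e.eval x) 0) (φ.symm r) := by
  have : Fintype ι := Fintype.ofEquiv _ φ.symm
  funext r
  simp only [Layer.apply, stepLayer, Pi.add_apply, Matrix.mulVec, dotProduct]
  by_cases hr : r = φ i
  · subst hr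
    simp only [if_true, Equiv.symm_apply_apply, Function.update_self]
    rw [← e.sum_coeff_mul x, ← Equiv.sum_comp φ.symm]
  · have hr' : φ.symm r ≠ i := fun h => hr (by simp [← h])
    simp [hr, hr', hx]

namespace RProg

/-- The network layers of a program, followed by given layers. -/
def prepend (φ : ι ≃ Fin D) (hD : 0 < D) : RProg ι → Layers D → Layers D
  | done, T => T
  | step i e rest, T => .cons hD (stepLayer φ i e) (rest.prepend φ hD T)
  | rep k body rest, T => (body.prepend φ hD)^[k] (rest.prepend φ hD T)

/-- The tokens of the network layers of a program. -/
def tokens (φ : ι ≃ Fin D) : RProg ι → List (List Letter)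
  | done => []
  | step i e rest => (stepLayer φ i e).tokens ++ rest.tokens φ
  | rep k body rest => (List.replicate k (body.tokens φ)).flatten ++ rest.tokens φ

/-- A short description of the network layers of a program. -/
def descr (φ : ι ≃ Fin D) : RProg ι → List Letter
  | done => []
  | step i e rest => commaJoin (stepLayer φ i e).tokens ++ rest.descr φ
  | rep k body rest =>
      .lparen :: body.descr φ ++ .rparen :: .star :: bin k ++ rest.descr φ

theorem eval_prepend (φ : ι ≃ Fin D) (hD : 0 < D) (p : RProg ι) (T : Layers D) {x : ι → ℤ}
    (hx : ∀ i, 0 ≤ x i) :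
    (p.prepend φ hD T).eval (fun c => x (φ.symm c)) = T.eval (fun c => p.exec x (φ.symm c)) := by
  induction p generalizing x T with
  | done => rfl
  | step i e rest ih =>
    simp only [prepend, Layers.eval, exec, relu_stepLayer φ i e hx]
    refine ih T (x := Function.update x i (max (e.eval x) 0)) ?_
    exact (step i e done).exec_nonneg hx
  | rep k body rest ihb ih =>
    simp only [prepend, exec]
    rw [← ih T (x := body.exec^[k] x) ((rep k body done).exec_nonneg hx)]
    generalize rest.prepend φ hD T = T'
    clear ih
    induction k generalizing x T' with
    | zero => rfl
    | succ k ihk =>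
      rw [Function.iterate_succ_apply', Function.iterate_succ_apply, ihb _ hx]
      exact ihk (body.exec_nonneg hx) T'

theorem tokens_prepend (φ : ι ≃ Fin D) (hD : 0 < D) (p : RProg ι) (T : Layers D) :
    (p.prepend φ hD T).tokens = p.tokens φ ++ T.tokens := by
  induction p generalizing T with
  | done => rfl
  | step i e rest ih => simp [prepend, tokens, Layers.tokens, ih]
  | rep k body rest ihb ih =>
    simp only [prepend, tokens, List.append_assoc, ← ih]
    generalize rest.prepend φ hD T = T'
    clear ih
    induction k with
    | zero => rfl
    | succ k ihk =>
      rw [Function.iterate_succ_apply', ihb, ihk, List.replicate_succ]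
      simp

theorem commaJoin_flatten_replicate (k : ℕ) (T : List (List Letter)) :
    commaJoin (List.replicate k T).flatten = (List.replicate k (commaJoin T)).flatten := by
  induction k with
  | zero => simp [commaJoin]
  | succ k ih => simp [List.replicate_succ, commaJoin_append, ih]

theorem head_descr_append (φ : ι ≃ Fin D) (p : RProg ι) {s : List Letter}
    (hs : s.head? ≠ some .zero ∧ s.head? ≠ some .one) :
    (p.descr φ ++ s).head? ≠ some .zero ∧ (p.descr φ ++ s).head? ≠ some .one := by
  cases p with
  | done => exact hs
  | step i e rest => simp [descr, Layer.tokens, commaJoin]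
  | rep k body rest => simp [descr]

theorem expands_descr_append (φ : ι ≃ Fin D) (p : RProg ι) {s t : List Letter} (h : Expands s t)
    (hs : s.head? ≠ some .zero ∧ s.head? ≠ some .one) :
    Expands (p.descr φ ++ s) (commaJoin (p.tokens φ) ++ t) := by
  induction p generalizing s t with
  | done => exact h
  | step i e rest ih =>
    simp only [descr, tokens, commaJoin_append, List.append_assoc]
    exact expands_append_of_plain (plain_commaJoin (Layer.isToken _)) (ih h hs)
  | rep k body rest ihb ih =>
    have hb : Expands (body.descr φ) (commaJoin (body.tokens φ)) := by
      simpa using ihb .nil (by simp)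
    have := Expands.rep k hb (ih h hs) (head_descr_append φ rest hs)
    simpa [descr, tokens, commaJoin_append, commaJoin_flatten_replicate] using this

end RProg

end Layers

theorem Layer.length_tokens {n m : ℕ} (g : Layer n m) : g.tokens.length = m * n + m + 2 := by
  simp [Layer.tokens, List.length_flatten, Function.comp_def]
  omega

theorem Layer.length_token_le {n m K : ℕ} {g : Layer n m} (hW : ∀ r c, (g.W r c).natAbs < 2 ^ K)
    (hb : ∀ r, (g.b r).natAbs < 2 ^ K) : ∀ l ∈ g.tokens, l.length ≤ K + 2 := by
  intro l hl
  simp only [Layer.tokens, List.mem_append, List.mem_cons, List.mem_flatten, List.mem_ofFn] at hl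
  rcases hl with (rfl | ⟨_, ⟨r, rfl⟩, hl⟩) | rfl | ⟨r, rfl⟩
  · simp
  · simp only [List.mem_ofFn] at hl
    obtain ⟨c, rfl⟩ := hl
    exact length_binInt_le (hW _ _)
  · simp
  · exact length_binInt_le (hb _)

theorem Layer.length_commaJoin_le {n m K : ℕ} {g : Layer n m}
    (hW : ∀ r c, (g.W r c).natAbs < 2 ^ K) (hb : ∀ r, (g.b r).natAbs < 2 ^ K) :
    (commaJoin g.tokens).length ≤ (m * n + m + 2) * (K + 3) := by
  simpa [Layer.length_tokens] using MDL.length_commaJoin_le (Layer.length_token_le hW hb)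

theorem RProg.length_descr_le {ι : Type} [DecidableEq ι] {D K : ℕ} (φ : ι ≃ Fin D) (p : RProg ι)
    (hp : p.DigitsLE K) (h1K : 1 < 2 ^ K) : (p.descr φ).length ≤ p.size * ((D * D + D + 2) * (K + 3)) := by
  have hK : K + 4 ≤ (D * D + D + 2) * (K + 3) := by nlinarith
  induction p with
  | done => simp [descr]
  | step i e rest ih =>
    have h1 : (commaJoin (stepLayer φ i e).tokens).length ≤ (D * D + D + 2) * (K + 3) := by
      refine Layer.length_commaJoin_le (fun r c => ?_) fun r => ?_
      · simp only [stepLayer]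
        split_ifs
        · exact (e.natAbs_coeff_le _).trans_lt hp.1
        · simpa using h1K
        · simp
      · simp only [stepLayer]
        split_ifs
        · exact (e.natAbs_const_le).trans_lt hp.1
        · simp
    have h2 := ih hp.2
    simp only [descr, size, List.length_append]
    rw [Nat.add_mul, Nat.one_mul]
    exact Nat.add_le_add h1 h2
  | rep k body rest ihb ih =>
    have h1 := ihb hp.2.1
    have h2 := ih hp.2.2
    have h3 := length_bin_le k
    have h4 := Nat.size_le.2 hp.1
    simp only [descr, size, List.length_append, List.length_cons]
    generalize (D * D + D + 2) * (K + 3) = Q at *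
    rw [Nat.add_mul, Nat.add_mul, Nat.one_mul]
    omega

theorem Expands.of_cons {a : Letter} {s t : List Letter} (h : Expands (a :: s) (a :: t))
    (ha : a ≠ .lparen) : Expands s t := by
  generalize ht : a :: t = t' at h
  cases h with
  | letter b hb h =>
    obtain rfl := (List.cons.inj ht).2
    exact h
  | rep k hu hs hd => exact absurd rfl ha

/-- The input vector without fixed coordinates. -/
def InputSpec.allFree : (I : ℕ) → InputSpec I I
  | 0 => .nil
  | I + 1 => .free (allFree I)

theorem InputSpec.fill_allFree (I : ℕ) (x : Fin I → ℤ) : (allFree I).fill x = x := by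
  induction I with
  | zero => exact Subsingleton.elim _ _
  | succ I ih => simp [allFree, fill, ih]

theorem InputSpec.length_allFree_token {I : ℕ} : ∀ l ∈ (allFree I).tokens, l.length = 1 := by
  induction I with
  | zero => simp [allFree, tokens]
  | succ I ih => simpa [allFree, tokens] using ih

/-- A program with given affine initial values and a given output coordinate is a network, whose
description length is linear in the size of the program. -/
theorem RProg.exists_network {ι : Type} [DecidableEq ι] {I D K : ℕ} (φ : ι ≃ Fin D) (p : RProg ι)
    (hp : p.DigitsLE K) (hK : 1 ≤ K) (ini : ι → Affine (Fin I)) (hini : ∀ i, (ini i).mag < 2 ^ K)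
    (o : ι) :
    ∃ F : Network I, (∀ x, F.eval x = p.exec (fun i => max ((ini i).eval x) 0) o) ∧
      F.descLength ≤
        (I + (D * I + D + 2) + p.size * (D * D + D + 2) + (D + 3)) * (K + 3) := by
  have h1K : 1 < 2 ^ K := Nat.one_lt_two_pow (by omega)
  have hD : 0 < D := (Nat.zero_le _).trans_lt (φ o).2
  let first : Layer I D := ⟨fun r c => (ini (φ.symm r)).coeff c, fun r => (ini (φ.symm r)).const⟩
  let final : Layer D 1 := ⟨fun _ c => if c = φ o then 1 else 0, fun _ => 0⟩
  let F : Network I := ⟨I, .allFree I, .cons hD first (p.prepend φ hD (.last final))⟩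
  have hF : F.inputs.tokens ++ F.layers.tokens = (InputSpec.allFree I).tokens ++ first.tokens ++
      (p.tokens φ ++ final.tokens) := by
    simp [F, Layers.tokens, tokens_prepend]
  let s := commaJoin ((InputSpec.allFree I).tokens ++ first.tokens) ++
    (p.descr φ ++ commaJoin final.tokens)
  have hs : Expands s (.comma :: F.encode) := by
    have hfin : Expands (commaJoin final.tokens) (commaJoin final.tokens) := by
      simpa using expands_append_of_plain (plain_commaJoin final.isToken) .nil
    have := expands_append_of_plain (l := commaJoin ((InputSpec.allFree I).tokens ++ first.tokens))
      (plain_commaJoin (by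
        intro l hl
        rcases List.mem_append.1 hl with hl | hl
        · exact InputSpec.isToken _ l hl
        · exact first.isToken l hl))
      (p.expands_descr_append φ hfin (by simp [commaJoin, Layer.tokens]))
    rw [← commaJoin_append, ← commaJoin_append, ← hF, ← comma_cons_intercalate F.tokens_ne_nil]
      at this
    exact this
  refine ⟨F, fun x => ?_, ?_⟩
  · have h1 : (fun r => max (first.apply x r) 0) =
        fun r => (fun i => max ((ini i).eval x) 0) (φ.symm r) := by
      funext r
      simp only [first, Layer.apply, Pi.add_apply, Matrix.mulVec, dotProduct,
        ← Affine.sum_coeff_mul]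
    simp only [Network.eval, F, Layers.eval, InputSpec.fill_allFree]
    rw [h1, p.eval_prepend φ hD _ (x := fun i => max ((ini i).eval x) 0) (by simp)]
    simp [Layers.eval, Layer.apply, final, Matrix.mulVec, dotProduct]
  · obtain ⟨s', hs', hlen⟩ : ∃ s', Expands s' F.encode ∧ s'.length ≤ s.length := by
      obtain ⟨l, T, hT⟩ : ∃ l T, (InputSpec.allFree I).tokens ++ first.tokens = l :: T :=
        List.exists_cons_of_ne_nil (by simp [Layer.tokens])
      have h : s = .comma :: (l ++ commaJoin T ++ (p.descr φ ++ commaJoin final.tokens)) := by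
        simp only [s, hT]
        simp [commaJoin]
      rw [h] at hs
      exact ⟨_, hs.of_cons (by simp), by simp [h]⟩
    refine (Network.descLength_le hs').trans (hlen.trans ?_)
    have h1 : (commaJoin (InputSpec.allFree I).tokens).length ≤ I * (K + 3) := by
      have := length_commaJoin_le (T := (InputSpec.allFree I).tokens) (k := K + 2)
        fun l hl => by rw [InputSpec.length_allFree_token l hl]; omega
      rwa [InputSpec.length_tokens] at this
    have h2 : (commaJoin first.tokens).length ≤ (D * I + D + 2) * (K + 3) :=
      Layer.length_commaJoin_le (fun r c => (Affine.natAbs_coeff_le _ _).trans_lt (hini _))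
        fun r => (Affine.natAbs_const_le _).trans_lt (hini _)
    have h3 : (commaJoin final.tokens).length ≤ (1 * D + 1 + 2) * (K + 3) := by
      refine Layer.length_commaJoin_le (fun r c => ?_) fun r => ?_
      · simp only [final]
        split_ifs <;> simp
        omega
      · simp [final]
    have h4 := p.length_descr_le φ hp h1K
    simp only [s, commaJoin_append, List.length_append]
    simp only [Nat.add_mul, Nat.mul_assoc, Nat.one_mul] at h1 h2 h3 h4 ⊢
    omega

/-! ### Translation of simple neural programs into straight-line ReLU programs -/

/-- The coordinates of the simulation: the variables, for every variable a slot that keeps the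
final value of a loop with this counter, a gate, which is `0` if and only if statements are
currently to be executed, and three temporary coordinates. -/
inductive Coord (V : ℕ) : Type
  | var (v : Fin V)
  | slot (v : Fin V)
  | gate
  | act
  | tmp
  | aux
  deriving DecidableEq

def Coord.equivSum (V : ℕ) : Coord V ≃ (Fin V ⊕ Fin V) ⊕ Fin 4 where
  toFun
    | .var v => .inl (.inl v)
    | .slot v => .inl (.inr v)
    | .gate => .inr 0
    | .act => .inr 1
    | .tmp => .inr 2
    | .aux => .inr 3
  invFun
    | .inl (.inl v) => .var v
    | .inl (.inr v) => .slot v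
    | .inr 0 => .gate
    | .inr 1 => .act
    | .inr 2 => .tmp
    | .inr 3 => .aux
  left_inv k := by cases k <;> rfl
  right_inv k := by
    rcases k with (v | v) | k
    · rfl
    · rfl
    · fin_cases k <;> rfl

def Coord.equiv (V : ℕ) : Coord V ≃ Fin (V + V + 4) :=
  ((Coord.equivSum V).trans (finSumFinEquiv.sumCongr (Equiv.refl _))).trans finSumFinEquiv

variable {V : ℕ}

def Operand.affine : Operand V → Affine (Coord V)
  | .var v => ⟨[(1, .var v)], 0⟩
  | .const c => ⟨[], c⟩

/-- The affine form `a - b + c`. -/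
def Operand.diff (a b : Operand V) (c : ℤ) : Affine (Coord V) :=
  ⟨a.affine.terms ++ b.affine.terms.map (fun p => (-p.1, p.2)),
    a.affine.const - b.affine.const + c⟩

/-- Affine forms `e₁`, `e₂` such that the comparison holds if and only if both are at most `0`. -/
def Cmp.forms (a b : Operand V) : Cmp → Affine (Coord V) × Affine (Coord V)
  | .eq => (a.diff b 0, b.diff a 0)
  | .lt => (a.diff b 1, a.diff b 1)
  | .gt => (b.diff a 1, b.diff a 1)
  | .le => (a.diff b 0, a.diff b 0)
  | .ge => (b.diff a 0, b.diff a 0)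

/-- The value of a comparison, written to `tmp`. -/
def Cmp.prog (r : Cmp) (a b : Operand V) : RProg (Coord V) :=
  .step .aux (r.forms a b).1 <| .step .tmp (r.forms a b).2 <|
    .step .tmp ⟨[(-1, .tmp), (-1, .aux)], 1⟩ .done

/-- The value of a simple statement, written to `tmp`. -/
def Simple.valProg (M B : ℕ) : Simple V → RProg (Coord V)
  | .assign _ a => .step .tmp a.affine .done
  | .ite _ a c b =>
      .step .tmp ⟨((M : ℤ), .var c) :: a.affine.terms, a.affine.const - M⟩ <|
        .step .aux ⟨(-(M : ℤ), .var c) :: b.affine.terms, b.affine.const⟩ <|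
          .step .tmp ⟨[(1, .tmp), (1, .aux)], 0⟩ .done
  | .addConst _ j c => .step .tmp ⟨[(1, .var j)], max c (-B)⟩ .done
  | .mulConst _ c j => .step .tmp ⟨[((c : ℤ), .var j)], 0⟩ .done
  | .cmpConst _ r j c => r.prog (.var j) (.const c)
  | .add _ j k => .step .tmp ⟨[(1, .var j), (1, .var k)], 0⟩ .done
  | .sub _ j k => .step .tmp ⟨[(1, .var j), (-1, .var k)], 0⟩ .done
  | .cmp _ r j k => r.prog (.var j) (.var k)

/-- The variable `i` takes the value of `tmp` if the gate is `0`. -/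
def gatedUpdate (M : ℕ) (i : Fin V) : RProg (Coord V) :=
  .step .act ⟨[(-1, .gate)], 1⟩ <|
    .step .tmp ⟨[(1, .tmp), (-(M : ℤ), .gate)], 0⟩ <|
      .step (.var i) ⟨[(1, .var i), (-(M : ℤ), .act)], 0⟩ <|
        .step (.var i) ⟨[(1, .var i), (1, .tmp)], 0⟩ .done

def Simple.compile (M B : ℕ) (s : Simple V) : RProg (Coord V) :=
  (s.valProg M B).append (gatedUpdate M s.target)

/-- One iteration of a loop with counter `i`: the gate is raised before the clause unless the
clause is to be executed, and lowered after it. -/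
def iteration (i : Fin V) (body : RProg (Coord V)) : RProg (Coord V) :=
  .step .tmp ⟨[(1, .var i), (-1, .slot i)], 0⟩ <|
    .step .tmp ⟨[(-1, .tmp), (-1, .gate)], 1⟩ <|
      .step .gate ⟨[(1, .gate), (-1, .tmp)], 1⟩ <|
        body.append <|
          .step .act ⟨[(-1, .gate)], 1⟩ <|
            .step (.var i) ⟨[(1, .var i), (1, .act)], 0⟩ <|
              .step .gate ⟨[(1, .gate)], -1⟩ .done

def Code.compile (M B : ℕ) : Code V → RProg (Coord V)
  | .done => .done
  | .step s rest => (s.compile M B).append (rest.compile M B)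
  | .loop i s e body rest =>
      .step (.slot i) e.affine <|
        ((Simple.assign i s).compile M B).append <|
          .rep (B + 1) (iteration i (body.compile M B)) (rest.compile M B)

/-- The coordinates `x` represent the state `σ` and the gate `g`. -/
structure Represents (x : Coord V → ℤ) (σ : State V) (g : ℤ) : Prop where
  nonneg : ∀ k, 0 ≤ x k
  var : ∀ v, x (.var v) = σ v
  gate : x .gate = g

theorem Represents.gate_nonneg {x : Coord V → ℤ} {σ : State V} {g : ℤ} (h : Represents x σ g) :
    0 ≤ g := h.gate ▸ h.nonneg _

/-- The states that are allowed in a `B`-bounded run. -/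
def Good {I : ℕ} (decl : Fin V → VarDecl I) (B : ℕ) (σ : State V) : Prop :=
  ∀ v, 0 ≤ σ v ∧ σ v ≤ B ∧ ((decl v).IsBool → σ v ≤ 1)

theorem Operand.eval_affine {x : Coord V → ℤ} {σ : State V} {g : ℤ} (h : Represents x σ g)
    (a : Operand V) : a.affine.eval x = a.val σ := by
  cases a <;> simp [affine, Affine.eval, Operand.val, h.var]

theorem Operand.eval_diff {x : Coord V → ℤ} (a b : Operand V) (c : ℤ) :
    (a.diff b c).eval x = a.affine.eval x - b.affine.eval x + c := by
  cases a <;> cases b <;> simp [diff, affine, Affine.eval] <;> ring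

theorem Operand.val_nonneg {σ : State V} (hσ : ∀ v, 0 ≤ σ v) (a : Operand V) : 0 ≤ a.val σ := by
  cases a <;> simp [Operand.val, hσ]

theorem Operand.val_le {B : ℕ} {σ : State V} (hσ : ∀ v, σ v ≤ B) {a : Operand V}
    (ha : a.ConstLE B) : a.val σ ≤ B := by
  cases a
  · exact hσ _
  · simpa [Operand.val, Operand.ConstLE] using ha

theorem Cmp.val_eq_of_forms {x : Coord V → ℤ} (r : Cmp) (a b : Operand V) :
    max (1 - max ((r.forms a b).2.eval x) 0 - max ((r.forms a b).1.eval x) 0) 0 =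
      r.val (a.affine.eval x) (b.affine.eval x) := by
  cases r <;> simp only [forms, Operand.eval_diff, Cmp.val] <;> split_ifs <;> omega

theorem Cmp.val_mem (r : Cmp) (a b : ℤ) : 0 ≤ r.val a b ∧ r.val a b ≤ 1 := by
  cases r <;> simp only [Cmp.val] <;> split_ifs <;> simp

theorem Operand.affine_eval_update_tmp (a : Operand V) (x : Coord V → ℤ) (z : ℤ) :
    a.affine.eval (Function.update x .tmp z) = a.affine.eval x ∧
      a.affine.eval (Function.update x .aux z) = a.affine.eval x := by
  cases a <;> simp [affine, Affine.eval]

theorem Cmp.exec_prog_tmp (r : Cmp) (a b : Operand V) (x : Coord V → ℤ) :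
    (r.prog a b).exec x .tmp = r.val (a.affine.eval x) (b.affine.eval x) := by
  have h : (r.forms a b).2.eval (Function.update x .aux (max ((r.forms a b).1.eval x) 0)) =
      (r.forms a b).2.eval x := by
    cases r <;> simp only [forms, Operand.eval_diff, (Operand.affine_eval_update_tmp _ _ _).2]
  rw [← r.val_eq_of_forms]
  simp only [prog, RProg.exec, Function.update_self, h]
  simp [Affine.eval]
  congr 1
  ring

theorem Simple.exec_valProg_of_ne {M B : ℕ} (s : Simple V) (x : Coord V → ℤ) {k : Coord V}
    (hk : k ≠ .tmp) (hk' : k ≠ .aux) : (s.valProg M B).exec x k = x k := by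
  cases s <;> simp [valProg, Cmp.prog, RProg.exec, hk, hk']

theorem Simple.exec_valProg_tmp {I M B : ℕ} (hM : 2 * B ≤ M) (hBM : B * B ≤ M) (hB : 1 ≤ B)
    {decl : Fin V → VarDecl I} {s : Simple V} (hs : s.WellTyped decl) (hc : s.ConstLE B)
    {x : Coord V → ℤ} {σ : State V} {g : ℤ} (h : Represents x σ g) (hσ : Good decl B σ) :
    (s.valProg M B).exec x .tmp ≤ M ∧ (0 ≤ s.val σ → (s.valProg M B).exec x .tmp = s.val σ) := by
  have h0 : ∀ v, 0 ≤ σ v := fun v => (hσ v).1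
  have h1 : ∀ v, σ v ≤ B := fun v => (hσ v).2.1
  cases s with
  | assign i a =>
    have := a.val_le h1 hc
    have := a.val_nonneg h0
    simp only [valProg, RProg.exec, Function.update_self, a.eval_affine h, Simple.val]
    omega
  | ite i a c b =>
    have ha := a.val_le h1 hc.1
    have hb := b.val_le h1 hc.2
    have ha0 := a.val_nonneg h0
    have hb0 := b.val_nonneg h0
    have hcc := (hσ c).2.2 hs
    have hc0 := h0 c
    have e1 : ∀ y : Coord V → ℤ, (⟨((M : ℤ), Coord.var c) :: a.affine.terms,
        a.affine.const - M⟩ : Affine (Coord V)).eval y =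
        M * y (.var c) + a.affine.eval y - M := by
      intro y; simp [Affine.eval]; ring
    have e2 : ∀ y : Coord V → ℤ, (⟨(-(M : ℤ), Coord.var c) :: b.affine.terms,
        b.affine.const⟩ : Affine (Coord V)).eval y =
        - M * y (.var c) + b.affine.eval y := by
      intro y; simp [Affine.eval]; ring
    have key : ((Simple.ite i a c b).valProg M B).exec x .tmp =
        max (max (M * σ c + a.val σ - M) 0 + max (-M * σ c + b.val σ) 0) 0 := by
      simp only [valProg, RProg.exec, Function.update_self, e1, e2,
        (Operand.affine_eval_update_tmp _ _ _).1, a.eval_affine h, b.eval_affine h]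
      simp [Affine.eval, h.var]
    rw [key]
    simp only [Simple.val]
    obtain hc1 | hc1 : σ c = 0 ∨ σ c = 1 := by omega
    · rw [hc1]; simp; omega
    · rw [hc1]; simp; omega
  | addConst i j c =>
    have := h0 j
    have := h1 j
    simp only [Simple.ConstLE] at hc
    simp [valProg, RProg.exec, Affine.eval, h.var, Simple.val]
    omega
  | mulConst i c j =>
    have h2 := h0 j
    have h3 := h1 j
    simp only [Simple.ConstLE] at hc
    have : (c : ℤ) * σ j ≤ B * B := mul_le_mul (by exact_mod_cast hc) h3 h2 (by positivity)
    have : (B : ℤ) * B ≤ M := by exact_mod_cast hBM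
    simp [valProg, RProg.exec, Affine.eval, h.var, Simple.val]
    omega
  | cmpConst i r j c =>
    have := r.val_mem (σ j) c
    have e := r.exec_prog_tmp (.var j) (.const c) x
    rw [Operand.eval_affine h, Operand.eval_affine h] at e
    simp only [valProg, e, Simple.val, Operand.val, implies_true, and_true]
    omega
  | add i j k =>
    have := h0 j
    have := h1 j
    have := h0 k
    have := h1 k
    simp [valProg, RProg.exec, Affine.eval, h.var, Simple.val]
    omega
  | sub i j k =>
    have := h0 j
    have := h1 j
    have := h0 k
    have := h1 k
    simp [valProg, RProg.exec, Affine.eval, h.var, Simple.val]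
    omega
  | cmp i r j k =>
    have := r.val_mem (σ j) (σ k)
    have e := r.exec_prog_tmp (.var j) (.var k) x
    rw [Operand.eval_affine h, Operand.eval_affine h] at e
    simp only [valProg, e, Simple.val, Operand.val, implies_true, and_true]
    omega

theorem exec_gatedUpdate {M : ℕ} {i : Fin V} {x : Coord V → ℤ} {σ : State V} {g : ℤ}
    (h : Represents x σ g) (hi : σ i ≤ M) (ht : x .tmp ≤ M) :
    Represents ((gatedUpdate M i).exec x) (if g = 0 then Function.update σ i (x .tmp) else σ) g ∧
      ∀ v, (gatedUpdate M i).exec x (.slot v) = x (.slot v) := by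
  have hg := h.gate_nonneg
  have hi0 : 0 ≤ σ i := h.var i ▸ h.nonneg _
  have ht0 := h.nonneg .tmp
  refine ⟨⟨RProg.exec_nonneg _ h.nonneg, fun v => ?_, ?_⟩, fun v => ?_⟩
  · by_cases hv : v = i
    · subst hv
      simp only [gatedUpdate, RProg.exec]
      simp [Affine.eval, h.var, h.gate]
      split_ifs with hg0
      · subst hg0; simp; omega
      · have : (M : ℤ) ≤ M * g := by nlinarith [show 1 ≤ g by omega]
        have : max (-g + 1) 0 = 0 := by omega
        rw [this]; simp; omega
    · simp only [gatedUpdate, RProg.exec]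
      simp [hv, h.var]
      split_ifs <;> simp [hv]
  · simp [gatedUpdate, RProg.exec, h.gate]
  · simp [gatedUpdate, RProg.exec]

theorem Simple.exec_compile {I M B : ℕ} (hM : 2 * B ≤ M) (hBM : B * B ≤ M) (hB : 1 ≤ B)
    {decl : Fin V → VarDecl I} {s : Simple V} (hs : s.WellTyped decl) (hc : s.ConstLE B)
    {x : Coord V → ℤ} {σ : State V} {g : ℤ} (h : Represents x σ g) (hσ : Good decl B σ)
    (hval : g = 0 → 0 ≤ s.val σ) :
    Represents ((s.compile M B).exec x) (if g = 0 then s.exec σ else σ) g ∧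
      ∀ v, (s.compile M B).exec x (.slot v) = x (.slot v) := by
  obtain ⟨h1, h2⟩ := s.exec_valProg_tmp hM hBM hB hs hc h hσ
  have h3 : Represents ((s.valProg M B).exec x) σ g :=
    ⟨RProg.exec_nonneg _ h.nonneg,
      fun v => by rw [exec_valProg_of_ne _ _ (by simp) (by simp), h.var],
      by rw [exec_valProg_of_ne _ _ (by simp) (by simp), h.gate]⟩
  obtain ⟨h4, h5⟩ := exec_gatedUpdate (i := s.target) h3
    (by have := (hσ s.target).2.1; omega) h1
  rw [Simple.compile, RProg.exec_append]
  refine ⟨?_, fun v => by rw [h5, exec_valProg_of_ne _ _ (by simp) (by simp)]⟩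
  split_ifs at h4 ⊢ with hg
  · rwa [h2 (hval hg)] at h4
  · exact h4

theorem Code.AllStates.head {p : State V → Prop} {c : Code V} {σ : State V}
    (h : c.AllStates p σ) : p σ := by
  cases c with
  | done => exact h
  | step s rest => exact h.1
  | loop i s e body rest => exact h.1

theorem Code.exec_of_not_modifies {v : Fin V} {c : Code V} (hv : ¬ c.Modifies v) (σ : State V) :
    c.exec σ v = σ v := by
  induction c generalizing σ with
  | done => rfl
  | step s rest ih =>
    simp only [Modifies, not_or] at hv
    rw [exec, ih hv.2, Simple.exec, Function.update_of_ne (Ne.symm hv.1)]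
  | loop i s e body rest ihb ih =>
    simp only [Modifies, not_or] at hv
    rw [exec, ih hv.2.2]
    have : ∀ n, ∀ τ : State V,
        (fun τ => Function.update (body.exec τ) i (body.exec τ i + 1))^[n] τ v = τ v := by
      intro n
      induction n with
      | zero => intro τ; rfl
      | succ n ihn =>
        intro τ
        rw [Function.iterate_succ_apply, ihn, Function.update_of_ne (Ne.symm hv.1), ihb hv.2.1]
    rw [this, Function.update_of_ne (Ne.symm hv.1)]

/-- `p` simulates the block `c` on good states: it performs `c` if the gate is `0`, nothing if the
gate is positive, and keeps the slots of the variables that are not modified by `c`. -/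
def Simulates {I : ℕ} (decl : Fin V → VarDecl I) (B : ℕ) (p : RProg (Coord V)) (c : Code V) :
    Prop :=
  ∀ ⦃x σ g⦄, Represents x σ g → Good decl B σ → (g = 0 → c.AllStates (Good decl B) σ) →
    Represents (p.exec x) (if g = 0 then c.exec σ else σ) g ∧
      ∀ v, ¬ c.Modifies v → p.exec x (.slot v) = x (.slot v)

theorem Simulates.iteration {I B : ℕ} {decl : Fin V → VarDecl I} {p : RProg (Coord V)}
    {c : Code V} (hp : Simulates decl B p c) {i : Fin V} {x : Coord V → ℤ} {σ : State V} {g : ℤ}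
    (h : Represents x σ g) (hσ : Good decl B σ)
    (hc : g = 0 → σ i ≤ x (.slot i) → c.AllStates (Good decl B) σ) :
    Represents ((iteration i p).exec x)
        (if g = 0 ∧ σ i ≤ x (.slot i) then Function.update (c.exec σ) i (c.exec σ i + 1) else σ) g ∧
      ∀ v, ¬ c.Modifies v → (iteration i p).exec x (.slot v) = x (.slot v) := by
  have hg := h.gate_nonneg
  let y := RProg.exec (.step .tmp ⟨[(1, .var i), (-1, .slot i)], 0⟩ <|
    .step .tmp ⟨[(-1, .tmp), (-1, .gate)], 1⟩ <|
      .step .gate ⟨[(1, .gate), (-1, .tmp)], 1⟩ .done) x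
  have hy : Represents y σ (if g = 0 ∧ σ i ≤ x (.slot i) then 0 else g + 1) := by
    refine ⟨RProg.exec_nonneg _ h.nonneg, fun v => by simp [y, RProg.exec, h.var], ?_⟩
    simp [y, RProg.exec, Affine.eval, h.var, h.gate]
    split_ifs <;> omega
  have hslot : ∀ v, y (.slot v) = x (.slot v) := fun v => by simp [y, RProg.exec]
  have hexec : (MDL.iteration i p).exec x = RProg.exec (.step .act ⟨[(-1, .gate)], 1⟩ <|
      .step (.var i) ⟨[(1, .var i), (1, .act)], 0⟩ <|
        .step .gate ⟨[(1, .gate)], -1⟩ .done) (p.exec y) := by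
    simp only [MDL.iteration, RProg.exec, RProg.exec_append, y]
  rw [hexec]
  obtain ⟨h1, h2⟩ := hp hy hσ (by
    intro h0
    split_ifs at h0 with hh
    · exact hc hh.1 hh.2
    · omega)
  generalize p.exec y = z at h1 h2 ⊢
  have hend : ∀ {τ : State V} {g' : ℤ}, Represents z τ g' →
      Represents (RProg.exec (.step .act ⟨[(-1, .gate)], 1⟩ <|
      .step (.var i) ⟨[(1, .var i), (1, .act)], 0⟩ <|
        .step .gate ⟨[(1, .gate)], -1⟩ .done) z)
        (if g' = 0 then Function.update τ i (τ i + 1) else τ) (max (g' - 1) 0) := by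
    intro τ g' hz
    have hg' := hz.gate_nonneg
    refine ⟨RProg.exec_nonneg _ hz.nonneg, fun v => ?_, ?_⟩
    · have hv0 : 0 ≤ τ v := hz.var v ▸ hz.nonneg _
      by_cases hv : v = i
      · subst hv
        simp [RProg.exec, Affine.eval, hz.gate, hz.var]
        split_ifs with hh
        · simp [hh]; omega
        · omega
      · simp [RProg.exec, hv, hz.var]
        split_ifs <;> simp [hv]
    · simp [RProg.exec, Affine.eval, hz.gate]
      rfl
  refine ⟨?_, fun v hv => ?_⟩
  · by_cases hh : g = 0 ∧ σ i ≤ x (.slot i)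
    · simp only [if_pos hh, if_true] at h1
      simpa [hh] using hend h1
    · have hne : g + 1 ≠ 0 := by omega
      simp only [if_neg hh, if_neg hne] at h1
      simpa [hh, hne, hg] using hend h1
  · rw [← hslot, ← h2 v hv]
    simp [RProg.exec]

theorem Simulates.iterate_iteration {I B : ℕ} {decl : Fin V → VarDecl I} {p : RProg (Coord V)}
    {c : Code V} (hp : Simulates decl B p c) {i : Fin V} (hi : ¬ c.Modifies i)
    {x : Coord V → ℤ} {σ : State V} {g : ℤ} (h : Represents x σ g) (hσ : Good decl B σ)
    (hn : g ≠ 0 ∨ x (.slot i) < σ i) (n : ℕ) :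
    Represents ((MDL.iteration i p).exec^[n] x) σ g ∧
      ∀ v, ¬ c.Modifies v → (MDL.iteration i p).exec^[n] x (.slot v) = x (.slot v) := by
  induction n generalizing x with
  | zero => exact ⟨h, fun _ _ => rfl⟩
  | succ n ih =>
    obtain ⟨h1, h2⟩ := hp.iteration (i := i) h hσ (by intro h3 h4; omega)
    rw [if_neg (by omega)] at h1
    rw [Function.iterate_succ_apply]
    obtain ⟨h3, h4⟩ := ih h1 (by rwa [h2 i hi])
    exact ⟨h3, fun v hv => by rw [h4 v hv, h2 v hv]⟩

theorem Simulates.iterate_clause {I B : ℕ} {decl : Fin V → VarDecl I} {p : RProg (Coord V)}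
    {c : Code V} (hp : Simulates decl B p c) {i : Fin V} (hi : ¬ c.Modifies i)
    {x : Coord V → ℤ} {σ : State V} (h : Represents x σ 0) (n : ℕ)
    (hn : σ i + n ≤ x (.slot i) + 1)
    (hc : ∀ j < n, c.AllStates (Good decl B)
      ((fun τ => Function.update (c.exec τ) i (c.exec τ i + 1))^[j] σ)) :
    Represents ((MDL.iteration i p).exec^[n] x)
        ((fun τ => Function.update (c.exec τ) i (c.exec τ i + 1))^[n] σ) 0 ∧
      (fun τ => Function.update (c.exec τ) i (c.exec τ i + 1))^[n] σ i = σ i + n ∧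
      ∀ v, ¬ c.Modifies v → (MDL.iteration i p).exec^[n] x (.slot v) = x (.slot v) := by
  induction n with
  | zero => exact ⟨h, by simp, fun _ _ => rfl⟩
  | succ n ih =>
    push_cast at hn
    obtain ⟨h1, h2, h3⟩ := ih (by omega) fun j hj => hc j (by omega)
    have h4 := hc n (by omega)
    obtain ⟨h5, h6⟩ := hp.iteration (i := i) h1 h4.head (fun _ _ => h4)
    rw [if_pos ⟨rfl, by rw [h2, h3 i hi]; omega⟩] at h5
    simp only [Function.iterate_succ_apply']
    refine ⟨h5, ?_, fun v hv => by rw [h6 v hv, h3 v hv]⟩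
    rw [Function.update_self, Code.exec_of_not_modifies hi, h2]
    push_cast
    ring

theorem Code.simulates_compile {I M B : ℕ} (hM : 2 * B ≤ M) (hBM : B * B ≤ M) (hB : 1 ≤ B)
    {decl : Fin V → VarDecl I} {c : Code V} (hwf : c.WellFormed decl) (hc : c.ConstLE B) :
    Simulates decl B (c.compile M B) c := by
  induction c with
  | done =>
    intro x σ g h _ _
    simpa [compile, RProg.exec, exec] using h
  | step s rest ih =>
    intro x σ g h hσ hall
    obtain ⟨h1, h2⟩ := Simple.exec_compile hM hBM hB hwf.1 hc.1 h hσ (by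
      intro hg
      have := ((hall hg).2.head s.target).1
      simpa [Simple.exec] using this)
    obtain ⟨h3, h4⟩ := ih hwf.2 hc.2 h1
      (by
        split_ifs with hg
        · exact (hall hg).2.head
        · exact hσ)
      (fun hg => by rw [if_pos hg]; exact (hall hg).2)
    rw [compile, RProg.exec_append]
    refine ⟨?_, fun v hv => ?_⟩
    · split_ifs at h3 ⊢ <;> exact h3
    · simp only [Modifies, not_or] at hv
      rw [h4 v hv.2, h2]
  | loop i s e body rest ihb ih =>
    intro x σ g h hσ hall
    have h0 : ∀ v, 0 ≤ σ v := fun v => (hσ v).1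
    have h1 : ∀ v, σ v ≤ B := fun v => (hσ v).2.1
    obtain ⟨hi, -, hwb, hwr⟩ := hwf
    obtain ⟨hcs, hce, hcb, hcr⟩ := hc
    have hs0 := s.val_nonneg h0
    have he0 := e.val_nonneg h0
    have heB := e.val_le h1 hce
    have hb := ihb hwb hcb
    have hr := ih hwr hcr
    let y := Function.update x (.slot i) (max (e.affine.eval x) 0)
    have hy : Represents y σ g :=
      ⟨(RProg.step (Coord.slot i) e.affine .done).exec_nonneg h.nonneg,
        fun v => by simp [y, h.var], by simp [y, h.gate]⟩
    obtain ⟨h2, h3⟩ := Simple.exec_compile (s := .assign i s) hM hBM hB trivial hcs hy hσ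
      (fun _ => hs0)
    set z := ((Simple.assign i s).compile M B).exec y with hz
    have hzi : z (.slot i) = e.val σ := by
      rw [h3]
      simp [y, e.eval_affine h, he0]
    have hzv : ∀ v, v ≠ i → z (.slot v) = x (.slot v) := fun v hv => by
      rw [h3]
      simp [y, hv]
    have hexec : (compile M B (.loop i s e body rest)).exec x = (rest.compile M B).exec
        ((iteration i (body.compile M B)).exec^[B + 1] z) := by
      simp only [compile, RProg.exec, RProg.exec_append, hz, y]
    rw [hexec]
    by_cases hg : g = 0
    · subst hg
      obtain ⟨-, hclause, hrest⟩ := hall rfl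
      simp only [if_true] at h2
      have hσ' : (Simple.assign i s).exec σ = Function.update σ i (s.val σ) := rfl
      rw [hσ'] at h2
      obtain ⟨n, hn⟩ : ∃ n, n = (e.val σ + 1 - s.val σ).toNat := ⟨_, rfl⟩
      have hnB : n ≤ B + 1 := by omega
      simp only [if_true, exec]
      rw [← hn] at hclause hrest ⊢
      obtain ⟨m, hm⟩ : ∃ m, B + 1 = m + n := ⟨B + 1 - n, by omega⟩
      rw [hm, Function.iterate_add_apply]
      have h4 : Represents ((iteration i (body.compile M B)).exec^[n] z)
            ((fun τ => Function.update (body.exec τ) i (body.exec τ i + 1))^[n]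
              (Function.update σ i (s.val σ))) 0 ∧
          (fun τ => Function.update (body.exec τ) i (body.exec τ i + 1))^[n]
              (Function.update σ i (s.val σ)) i = s.val σ + n ∧
          ∀ v, ¬ body.Modifies v →
            (iteration i (body.compile M B)).exec^[n] z (.slot v) = z (.slot v) := by
        rcases Nat.eq_zero_or_pos n with hn0 | hn0
        · subst hn0
          exact ⟨h2, by simp, fun _ _ => rfl⟩
        · have := hb.iterate_clause hi h2 n
            (by rw [Function.update_self, hzi]; omega) hclause
          rwa [Function.update_self] at this
      obtain ⟨h4, h5, h6⟩ := h4
      obtain ⟨h7, h8⟩ := hb.iterate_iteration hi h4 hrest.head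
        (Or.inr (by rw [h5, h6 i hi, hzi]; omega)) m
      obtain ⟨h9, h10⟩ := hr h7 hrest.head (fun _ => hrest)
      refine ⟨by simpa using h9, fun v hv => ?_⟩
      simp only [Modifies, not_or] at hv
      rw [h10 v hv.2.2, h8 v hv.2.1, h6 v hv.2.1, hzv v (Ne.symm hv.1)]
    · simp only [if_neg hg] at h2 ⊢
      obtain ⟨h7, h8⟩ := hb.iterate_iteration hi h2 hσ (Or.inl hg) (B + 1)
      obtain ⟨h9, h10⟩ := hr h7 hσ (fun h => absurd h hg)
      refine ⟨by simpa [hg] using h9, fun v hv => ?_⟩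
      simp only [Modifies, not_or] at hv
      rw [h10 v hv.2.2, h8 v hv.2.1, hzv v (Ne.symm hv.1)]

/-! ### Size of the translation -/

theorem Simple.size_compile_le (M B : ℕ) (s : Simple V) : (s.compile M B).size ≤ 7 := by
  rw [compile, RProg.size_append]
  cases s <;> simp [valProg, Cmp.prog, gatedUpdate, RProg.size]

theorem Code.size_compile_le (M B : ℕ) (c : Code V) : (c.compile M B).size ≤ 15 * c.length := by
  induction c with
  | done => simp [compile, RProg.size, length]
  | step s rest ih =>
    have := s.size_compile_le M B
    rw [compile, RProg.size_append, length]
    omega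
  | loop i s e body rest ihb ih =>
    have := (Simple.assign i s).size_compile_le M B
    simp only [compile, iteration, RProg.size, RProg.size_append, length]
    omega

theorem Operand.mag_diff_le {B : ℕ} {a b : Operand V} (ha : a.ConstLE B) (hb : b.ConstLE B)
    (c : ℤ) : (a.diff b c).mag ≤ 2 + 2 * B + c.natAbs := by
  cases a <;> cases b <;> simp [diff, affine, Affine.mag, Operand.ConstLE] at * <;> omega

theorem Operand.mag_affine_le {B : ℕ} {a : Operand V} (ha : a.ConstLE B) :
    a.affine.mag ≤ 1 + B := by
  cases a
  · simp [affine, Affine.mag]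
  · simp [affine, Affine.mag, Operand.ConstLE] at *
    omega

theorem Cmp.digitsLE_prog {B K : ℕ} {a b : Operand V} (ha : a.ConstLE B) (hb : b.ConstLE B)
    (hK : 2 * B + 3 < 2 ^ K) (r : Cmp) : (r.prog a b).DigitsLE K := by
  have h0 := Operand.mag_diff_le ha hb 0
  have h1 := Operand.mag_diff_le ha hb 1
  have h2 := Operand.mag_diff_le hb ha 0
  have h3 := Operand.mag_diff_le hb ha 1
  simp only [Int.natAbs_zero, Int.natAbs_one] at h0 h1 h2 h3
  have h4 : (⟨[(-1, .tmp), (-1, .aux)], 1⟩ : Affine (Coord V)).mag < 2 ^ K := by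
    simp [Affine.mag]; omega
  cases r <;> refine ⟨?_, ?_, h4, trivial⟩ <;> simp only [forms] <;> omega

theorem gatedUpdate_digitsLE {M K : ℕ} (hK : M + 2 < 2 ^ K) (i : Fin V) :
    (gatedUpdate M i).DigitsLE K := by
  refine ⟨?_, ?_, ?_, ?_, trivial⟩ <;> simp [Affine.mag] <;> omega

theorem Simple.digitsLE_compile {M B K : ℕ} (hM : 2 * B ≤ M) (hB : 2 ≤ B)
    (hK : 4 * M < 2 ^ K) {s : Simple V} (hs : s.ConstLE B) : (s.compile M B).DigitsLE K := by
  refine RProg.DigitsLE.append ?_ (gatedUpdate_digitsLE (by omega) _)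
  cases s with
  | assign i a =>
    have := Operand.mag_affine_le (V := V) hs
    exact ⟨by omega, trivial⟩
  | ite i a c b =>
    have h1 := Operand.mag_affine_le (V := V) hs.1
    have h2 := Operand.mag_affine_le (V := V) hs.2
    simp only [Affine.mag] at h1 h2
    refine ⟨?_, ?_, ?_, trivial⟩ <;> simp [Affine.mag] <;> omega
  | addConst i j c =>
    simp only [Simple.ConstLE] at hs
    refine ⟨?_, trivial⟩
    simp [Affine.mag]
    omega
  | mulConst i c j =>
    simp only [Simple.ConstLE] at hs
    refine ⟨?_, trivial⟩
    simp [Affine.mag]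
    omega
  | cmpConst i r j c => exact Cmp.digitsLE_prog (B := B) (a := .var j) (b := .const c) trivial hs (by omega) r
  | add i j k => refine ⟨?_, trivial⟩; simp [Affine.mag]; omega
  | sub i j k => refine ⟨?_, trivial⟩; simp [Affine.mag]; omega
  | cmp i r j k => exact Cmp.digitsLE_prog (B := B) (a := .var j) (b := .var k) trivial trivial (by omega) r

theorem Code.digitsLE_compile {M B K : ℕ} (hM : 2 * B ≤ M) (hB : 2 ≤ B)
    (hK : 4 * M < 2 ^ K) {c : Code V} (hc : c.ConstLE B) : (c.compile M B).DigitsLE K := by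
  induction c with
  | done => trivial
  | step s rest ih => exact (Simple.digitsLE_compile hM hB hK hc.1).append (ih hc.2)
  | loop i s e body rest ihb ih =>
    obtain ⟨hs, he, hb, hr⟩ := hc
    have := Operand.mag_affine_le he
    refine ⟨by omega, (Simple.digitsLE_compile (s := .assign i s) hM hB hK hs).append
      ⟨by omega, ⟨?_, ?_, ?_, (ihb hb).append ⟨?_, ?_, ?_, trivial⟩⟩, ih hr⟩⟩ <;>
    simp [Affine.mag] <;> omega

/-! ### The network of a simple neural program -/

section Program

variable {I V N B : ℕ}

theorem SNP.card_inputs_le (P : SNP I V) : I ≤ V := by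
  choose f hf using fun k => (P.input_once k).exists
  have : Function.Injective f := fun a b h => by
    have := hf a
    rw [h, hf b] at this
    exact (VarDecl.input.inj this).symm
  simpa using Fintype.card_le_of_injective f this

/-- The initial value of a variable as an affine form in the inputs. -/
def VarDecl.affine : VarDecl I → Affine (Fin I)
  | .input k => ⟨[(1, k)], 0⟩
  | .int c => ⟨[], c⟩
  | .bool b => ⟨[], if b then 1 else 0⟩

/-- The initial values of the coordinates as affine forms in the inputs. -/
def SNP.initAffine (P : SNP I V) : Coord V → Affine (Fin I)
  | .var v => (P.decl v).affine
  | _ => ⟨[], 0⟩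

theorem SNP.eval_initAffine (P : SNP I V) (v : Fin V) (x : Fin I → ℤ) :
    (P.initAffine (.var v)).eval x = P.init x v := by
  simp only [initAffine, init]
  generalize P.decl v = d
  cases d <;> simp [VarDecl.affine, Affine.eval]

theorem SNP.IsBounded.good_init {P : SNP I V} (hP : P.IsBounded N B) (x : Grid N I) :
    Good P.decl B (P.init x.toInt) :=
  (hP.2 x).head

theorem SNP.IsBounded.mag_initAffine_le {P : SNP I V} (hP : P.IsBounded N B) (x : Grid N I)
    (hB : 1 ≤ B) (k : Coord V) : (P.initAffine k).mag ≤ B := by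
  cases k with
  | var v =>
    have h := (hP.good_init x v).2.1
    rw [← P.eval_initAffine] at h
    simp only [initAffine] at h ⊢
    generalize P.decl v = d at h ⊢
    cases d with
    | input k => simpa [VarDecl.affine, Affine.mag] using hB
    | int c => simpa [VarDecl.affine, Affine.mag, Affine.eval] using h
    | bool b => cases b <;> simp [VarDecl.affine, Affine.mag, hB]
  | _ => simp [initAffine, Affine.mag]

theorem SNP.IsBounded.exists_network {P : SNP I V} (hP : P.IsBounded N B) (hB : 2 ≤ B)
    (x₀ : Grid N I) :
    ∃ F : Network I, (∀ x : Grid N I, F.eval x.toInt = P.eval x.toInt) ∧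
      F.descLength ≤ 3300 * P.length * V ^ 2 * B.size := by
  have hBs : B < 2 ^ B.size := Nat.lt_size_self B
  have hs : 2 ≤ B.size := by
    by_contra h
    have : B < 2 ^ 1 := hBs.trans_le (Nat.pow_le_pow_right (by norm_num) (by omega))
    omega
  have hM : 2 * B ≤ B * B := Nat.mul_le_mul_right _ hB
  have hK : 4 * (B * B) < 2 ^ (2 * B.size + 2) := by
    have : B * B < 2 ^ B.size * 2 ^ B.size := Nat.mul_lt_mul'' hBs hBs
    rw [pow_add, two_mul, pow_add]
    omega
  obtain ⟨F, hF, hlen⟩ := (P.code.compile (B * B) B).exists_network (Coord.equiv V)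
    (Code.digitsLE_compile hM hB hK hP.1) (by omega) P.initAffine
    (fun k => (hP.mag_initAffine_le x₀ (by omega) k).trans_lt (by omega)) (.var P.ret)
  refine ⟨F, fun x => ?_, hlen.trans ?_⟩
  · have hrep : Represents (fun k => max ((P.initAffine k).eval x.toInt) 0)
        (P.init x.toInt) 0 :=
      ⟨fun k => le_max_right _ _,
        fun v => by simp only [P.eval_initAffine]; exact max_eq_left (hP.good_init x v).1,
        by simp [initAffine, Affine.eval]⟩
    have := (Code.simulates_compile hM le_rfl (by omega) P.wf hP.1 hrep (hP.good_init x)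
      fun _ => hP.2 x).1.var P.ret
    rw [hF, this, if_pos rfl, SNP.eval]
  · have hI := P.card_inputs_le
    have hV : 1 ≤ V := (Nat.zero_le _).trans_lt P.ret.2
    have hsize := P.code.size_compile_le (B * B) B
    generalize (P.code.compile (B * B) B).size = S at *
    have hVV : V ≤ V ^ 2 := by nlinarith
    have h1 : (V + V + 4) * (V + V + 4) + (V + V + 4) + 2 ≤ 44 * V ^ 2 := by nlinarith
    have h2 : I + ((V + V + 4) * I + (V + V + 4) + 2) + (V + V + 4 + 3) ≤ 24 * V ^ 2 := by
      have : (V + V + 4) * I ≤ (V + V + 4) * V := Nat.mul_le_mul_left _ hI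
      nlinarith
    have h3 : S * ((V + V + 4) * (V + V + 4) + (V + V + 4) + 2) ≤
        15 * P.code.length * (44 * V ^ 2) := Nat.mul_le_mul hsize h1
    calc _ ≤ (24 * V ^ 2 + 15 * P.code.length * (44 * V ^ 2)) * (5 * B.size) :=
          Nat.mul_le_mul (by omega) (by omega)
      _ ≤ (660 * P.length * V ^ 2) * (5 * B.size) := by
          refine Nat.mul_le_mul_right _ ?_
          rw [SNP.length]
          nlinarith
      _ = _ := by ring

theorem size_le_mul_log (hB : 2 ≤ B) : (B.size : ℝ) ≤ 3 * Real.log B := by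
  obtain ⟨m, hm⟩ : ∃ m, B.size = m + 1 :=
    Nat.exists_eq_succ_of_ne_zero (Nat.size_pos.2 (by omega)).ne'
  have h1 : 2 ^ m ≤ B := by
    by_contra h
    have := Nat.size_le.2 (not_le.1 h)
    omega
  have h2 : (m : ℝ) * Real.log 2 ≤ Real.log B := by
    rw [← Real.log_pow]
    exact Real.log_le_log (by positivity) (by exact_mod_cast h1)
  have h3 : Real.log 2 ≤ Real.log B := Real.log_le_log (by norm_num) (by exact_mod_cast hB)
  have h4 := Real.log_two_gt_d9
  rw [hm]
  push_cast
  nlinarith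

end Program

/-! ### The union bound -/

section Probability

variable {α Ω : Type*} [MeasurableSpace α] [Finite α] [MeasurableSingletonClass α]
  [MeasurableSpace Ω]

theorem real_forall_mem_le_exp {n : ℕ} {μ : Measure α} [IsProbabilityMeasure μ]
    {Pr : Measure Ω} {X : Fin n → Ω → α} (hX : ∀ i, Measurable (X i)) (hind : iIndepFun X Pr)
    (hmap : ∀ i, Measure.map (X i) Pr = μ) {A : Set α} {ε : ℝ} (hA : ε < μ.real Aᶜ) :
    Pr.real {ω | ∀ i, X i ω ∈ A} ≤ Real.exp (-(ε * n)) := by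
  have hAm : MeasurableSet A := A.toFinite.measurableSet
  have h1 : Pr {ω | ∀ i, X i ω ∈ A} = μ A ^ n := by
    have h := hind.measure_inter_preimage_eq_mul Finset.univ (sets := fun _ => A) fun _ _ => hAm
    have hset : {ω | ∀ i, X i ω ∈ A} = ⋂ i ∈ Finset.univ, X i ⁻¹' A := by ext; simp
    rw [hset, h]
    rw [Finset.prod_congr rfl fun i _ => by rw [← Measure.map_apply (hX i) hAm, hmap i]]
    simp
  rw [measureReal_def, h1, ENNReal.toReal_pow, ← measureReal_def]
  rw [probReal_compl_eq_one_sub hAm] at hA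
  calc μ.real A ^ n ≤ Real.exp (-ε) ^ n := by
        refine pow_le_pow_left₀ measureReal_nonneg ?_ n
        have := Real.add_one_le_exp (-ε)
        linarith
    _ = Real.exp (-(ε * n)) := by rw [← Real.exp_nat_mul]; ring_nf

theorem real_exists_consistent_le {τ : Type*} [Fintype τ] {n : ℕ} {μ : Measure α}
    [IsProbabilityMeasure μ] {Pr : Measure Ω} [IsProbabilityMeasure Pr] {X : Fin n → Ω → α}
    (hX : ∀ i, Measurable (X i)) (hind : iIndepFun X Pr)
    (hmap : ∀ i, Measure.map (X i) Pr = μ) (A : τ → Set α) (ε : ℝ) :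
    Pr.real {ω | ∃ t, ε < μ.real (A t)ᶜ ∧ ∀ i, X i ω ∈ A t} ≤
      Fintype.card τ * Real.exp (-(ε * n)) := by
  have hset : {ω | ∃ t, ε < μ.real (A t)ᶜ ∧ ∀ i, X i ω ∈ A t} =
      ⋃ t, {ω | ε < μ.real (A t)ᶜ ∧ ∀ i, X i ω ∈ A t} := by ext; simp
  rw [hset]
  refine (measureReal_iUnion_fintype_le _).trans ?_
  refine (Finset.sum_le_card_nsmul _ _ (Real.exp (-(ε * n))) fun t _ => ?_).trans_eq (by simp)
  by_cases ht : ε < μ.real (A t)ᶜ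
  · simpa [ht] using real_forall_mem_le_exp hX hind hmap ht
  · simpa [ht] using (Real.exp_pos _).le

end Probability

def Letter.finEquiv : Letter ≃ Fin 10 where
  toFun
    | .inp => 0 | .comma => 1 | .minus => 2 | .zero => 3 | .one => 4
    | .star => 5 | .lparen => 6 | .rparen => 7 | .weight => 8 | .bias => 9
  invFun
    | 0 => .inp | 1 => .comma | 2 => .minus | 3 => .zero | 4 => .one
    | 5 => .star | 6 => .lparen | 7 => .rparen | 8 => .weight | 9 => .bias
  left_inv a := by cases a <;> rfl
  right_inv a := by fin_cases a <;> rfl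

instance : Fintype Letter := Fintype.ofEquiv _ Letter.finEquiv.symm

theorem Letter.card : Fintype.card Letter = 10 := Fintype.card_congr finEquiv

/-- A list of length at most `m` is obtained from `m` optional letters. -/
theorem exists_reduceOption_ofFn {α : Type*} (l : List α) {m : ℕ} (h : l.length ≤ m) :
    ∃ t : Fin m → Option α, (List.ofFn t).reduceOption = l := by
  refine ⟨fun i => l[(i : ℕ)]?, ?_⟩
  have : (List.ofFn fun i : Fin m => l[(i : ℕ)]?) =
      l.map some ++ List.replicate (m - l.length) none := by
    refine List.ext_getElem (by simp; omega) fun i h1 h2 => ?_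
    by_cases hi : i < l.length
    · simp [hi]
    · rw [List.getElem_append_right (by simpa using hi)]
      simpa using hi
  rw [this, List.reduceOption_append, List.reduceOption_replicate_none, List.append_nil]
  simp [List.reduceOption]

end MDL

open MDL

theorem theorem5p1 :
    ∃ c₃ : ℝ, 0 < c₃ ∧
      ∀ (I V N B : ℕ) (P : MDL.SNP I V), 2 ≤ B → P.IsBounded N B →
      ∀ (ε δ : ℝ), 0 < ε → 0 < δ → δ < 1 →
      ∀ n : ℕ,
        (c₃ * (P.length : ℝ) ^ 3 * (V : ℝ) ^ 2 * Real.log B + Real.log (1 / δ)) / ε ≤ (n : ℝ) →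
      ∀ (μ : Measure (MDL.Grid N I)) [IsProbabilityMeasure μ]
        {Ω : Type*} [MeasurableSpace Ω] (Pr : Measure Ω) [IsProbabilityMeasure Pr]
        (X : Fin n → Ω → MDL.Grid N I),
        (∀ i, Measurable (X i)) → iIndepFun X Pr → (∀ i, Measure.map (X i) Pr = μ) →
        1 - δ ≤ Pr.real {ω |
          (∃ F : MDL.Network I, MDL.IsMDLInterpolator F
            (fun i => (X i ω).toInt) (fun i => P.eval (X i ω).toInt)) ∧
          ∀ F : MDL.Network I, MDL.IsMDLInterpolator F
              (fun i => (X i ω).toInt) (fun i => P.eval (X i ω).toInt) →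
            μ.real {x | F.eval x.toInt ≠ P.eval x.toInt} ≤ ε} := by
  refine ⟨30000, by norm_num, ?_⟩
  intro I V N B P hB hP ε δ hε hδ _ n hn μ _ Ω _ Pr _ X hX hind hmap
  obtain ⟨x₀⟩ : Nonempty (Grid N I) := nonempty_of_isProbabilityMeasure μ
  obtain ⟨F₀, hF₀, hlen⟩ := hP.exists_network hB x₀
  let A : (Fin F₀.descLength → Option Letter) → Set (Grid N I) := fun t =>
    {x | ∃ F : Network I, Describes (List.ofFn t).reduceOption F ∧ F.eval x.toInt = P.eval x.toInt}
  have hbad := real_exists_consistent_le hX hind hmap A ε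
  have hcard : (Fintype.card (Fin F₀.descLength → Option Letter) : ℝ) * Real.exp (-(ε * n)) ≤ δ := by
    have h11 : Real.log 11 ≤ 3 := by
      rw [Real.log_le_iff_le_exp (by norm_num)]
      have := Real.exp_one_gt_d9
      calc (11 : ℝ) ≤ 2.7 ^ 3 := by norm_num
        _ ≤ Real.exp 1 ^ 3 := by gcongr; linarith
        _ = Real.exp 3 := by rw [← Real.exp_nat_mul]; norm_num
    have hl : (F₀.descLength : ℝ) ≤ 3300 * P.length * V ^ 2 * (3 * Real.log B) :=
      (by exact_mod_cast hlen : (F₀.descLength : ℝ) ≤ 3300 * P.length * V ^ 2 * B.size).trans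
        (mul_le_mul_of_nonneg_left (size_le_mul_log hB) (by positivity))
    have hL : (1 : ℝ) ≤ P.length := by simp [SNP.length]
    have hlogB : 0 ≤ Real.log B := Real.log_natCast_nonneg B
    have hn' := (div_le_iff₀ hε).1 hn
    have hcube : (P.length : ℝ) * V ^ 2 * Real.log B ≤ P.length ^ 3 * V ^ 2 * Real.log B := by
      have : (P.length : ℝ) ≤ P.length ^ 3 := le_self_pow₀ hL (by norm_num)
      gcongr
    have h0 : 0 ≤ (P.length : ℝ) * V ^ 2 * Real.log B := by positivity
    have hmul : (F₀.descLength : ℝ) * Real.log 11 ≤ F₀.descLength * 3 := by gcongr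
    rw [one_div, Real.log_inv] at hn'
    calc _ = Real.exp (F₀.descLength * Real.log 11 - ε * n) := by
          rw [sub_eq_add_neg, Real.exp_add, Real.exp_nat_mul, Real.exp_log (by norm_num)]
          simp [Letter.card]
      _ ≤ Real.exp (Real.log δ) := by
          refine Real.exp_le_exp.2 ?_
          linarith
      _ = δ := Real.exp_log hδ
  set G := {ω | (∃ F : Network I, IsMDLInterpolator F
      (fun i => (X i ω).toInt) (fun i => P.eval (X i ω).toInt)) ∧
    ∀ F : Network I, IsMDLInterpolator F
        (fun i => (X i ω).toInt) (fun i => P.eval (X i ω).toInt) →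
      μ.real {x | F.eval x.toInt ≠ P.eval x.toInt} ≤ ε} with hG
  have hsub : Gᶜ ⊆ {ω | ∃ t, ε < μ.real (A t)ᶜ ∧ ∀ i, X i ω ∈ A t} := by
    intro ω hω
    have hint : Interpolates F₀ (fun i => (X i ω).toInt) (fun i => P.eval (X i ω).toInt) :=
      fun i => hF₀ _
    have hex : ∃ F : Network I, IsMDLInterpolator F
        (fun i => (X i ω).toInt) (fun i => P.eval (X i ω).toInt) := by
      obtain ⟨F, hF, hmin⟩ := (measure Network.descLength).wf.has_min
        {F | Interpolates F (fun i => (X i ω).toInt) (fun i => P.eval (X i ω).toInt)} ⟨F₀, hint⟩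
      exact ⟨F, hF, fun G hG => not_lt.1 (hmin G hG)⟩
    simp only [hG, Set.mem_compl_iff, Set.mem_ofPred_eq, not_and, not_forall, not_le] at hω
    obtain ⟨F, hF, hFε⟩ := hω hex
    obtain ⟨s, hs, hsl⟩ := F.exists_describes
    obtain ⟨t, rfl⟩ := exists_reduceOption_ofFn s (hsl.trans_le (hF.2 F₀ hint))
    refine ⟨t, ?_, fun i => ⟨F, hs, hF.1 i⟩⟩
    have : (A t)ᶜ = {x | F.eval x.toInt ≠ P.eval x.toInt} := by
      ext x
      simp only [A, Set.mem_compl_iff, Set.mem_ofPred_eq, not_exists, not_and]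
      exact ⟨fun h => h F hs, fun h F' hF' => by rwa [hF'.unique hs]⟩
    rwa [this]
  have h1 : (1 : ℝ) ≤ Pr.real G + Pr.real Gᶜ := by
    have := measureReal_union_le (μ := Pr) G Gᶜ
    rwa [Set.union_compl_self, probReal_univ] at this
  have h2 := measureReal_mono (μ := Pr) hsub
  linarith
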